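/- **Theorem (oblivious reliable spanners for general metrics).** A weighted graph $H$ on a finite metric space $(X,d_X)$ (with nonnegative edge weights, and shortest-path distance $d_H$, equal to $\infty$ between disconnected points) is *dominating* if $d_X(x,y)\le d_H(x,y)$ for all $x,y\in X$. For $\nu>0$ and $t\ge 1$, an *oblivious $\nu$-reliable $t$-spanner* of $(X,d_X)$ is a probability distribution $\mathcal D$ over dominating weighted graphs on $X$ such that for every $B\subseteq X$ one can choose, for every $H\in\mathrm{supp}(\mathcal D)$, a superset $B^+=B^+(H)\supseteq B$ with $$d_{H[X\setminus B]}(x,y)\le t\cdot d_X(x,y)\quad\text{for all }x,y\in X\setminus B^+,\qquad\text{and}\qquad \mathbb E_{H\sim\mathcal D}\big[|B^+|\big]\le(1+\nu)|B|.$$ It has $m$ edges if every $H\in\mathrm{supp}(\mathcal D)$ has at most $m$ edges. There are universal constants $C>0$ and $c\in\mathbb N$ such that for every $n$-point metric space $(X,d_X)$, every $\nu\in(0,1)$, every $\epsilon\in(0,\tfrac12)$ and every integer $k\ge1$, the space $(X,d_X)$ admits an oblivious $\nu$-reliable $(8k+\epsilon)$-spanner with at most $$n^{1+\frac1k}\cdot\nu^{-1}\cdot\log^{3}n\cdot\max\{1,\log\log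 n\}\cdot\frac{k^{4}}{\epsilon^{2}}\cdot\Big(C\log\frac{k}{\epsilon}\Big)^{2}$$ edges, and this same spanner also has at most $$n^{1+\frac1k}\cdot\nu^{-1}\cdot C f\log^{c}f,\qquad f=\log^{3}n\cdot\frac{k^{4}}{\epsilon^{2}},$$ edges, i.e. $n^{1+\frac1k}\cdot\nu^{-1}\cdot\tilde O\big(\log^{3}n\cdot\frac{k^{4}}{\epsilon^{2}}\big)$ edges (for $n\le 1$ both bounds are read as $0$). In particular the bounds do not depend on the aspect ratio of the metric. -/

import Mathlib

open scoped NNReal ENNReal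

/-- A weighted graph on the vertex set `X`: a simple undirected graph together with nonnegative
real edge weights. Only the values of `weight` on edges of `graph` are ever used. -/
structure WeightedGraph (X : Type*) where
  graph : SimpleGraph X
  weight : Sym2 X → ℝ≥0

namespace WeightedGraph

/-- The total weight of a walk, each edge being counted as often as it is traversed. -/
def walkWeight {X : Type*} (H : WeightedGraph X) {x y : X} (p : H.graph.Walk x y) : ℝ≥0 :=
  (p.edges.map H.weight).sum

/-- The shortest path distance `d_H(x, y)`; it is `∞` if `x` and `y` are not connected in `H`. -/
noncomputable def pathDist {X : Type*} (H : WeightedGraph X) (x y : X) : ℝ≥0∞ :=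
  ⨅ p : H.graph.Walk x y, (H.walkWeight p : ℝ≥0∞)

/-- The induced weighted subgraph `H[S]`, with vertex set `S`. -/
def induce {X : Type*} (H : WeightedGraph X) (S : Set X) : WeightedGraph S where
  graph := H.graph.induce S
  weight e := H.weight (e.map Subtype.val)

/-- `H` dominates the metric of `X`: `d_X(x, y) ≤ d_H(x, y)` for all `x, y`. -/
def Dominates {X : Type*} [MetricSpace X] (H : WeightedGraph X) : Prop :=
  ∀ x y : X, edist x y ≤ H.pathDist x y

/-- The number of edges of `H`. -/
noncomputable def numEdges {X : Type*} (H : WeightedGraph X) : ℕ :=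
  H.graph.edgeSet.ncard

end WeightedGraph

/-- The distribution `D` over weighted graphs on `X` is an oblivious `ν`-reliable `t`-spanner of the
metric space `X`. Here `Bplus H` is the faulty extension `B⁺ ⊇ B` of the attack set `B` in `H`,
and the series is its expected size `𝔼_{H ∼ D} |B⁺|`. -/
structure IsObliviousReliableSpanner {X : Type*} [MetricSpace X]
    (D : PMF (WeightedGraph X)) (ν t : ℝ) : Prop where
  dominates : ∀ H ∈ D.support, H.Dominates
  reliable : ∀ B : Finset X, ∃ Bplus : WeightedGraph X → Finset X,
    (∀ H ∈ D.support, B ⊆ Bplus H ∧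
      ∀ x y : ((B : Set X)ᶜ : Set X), (x : X) ∉ Bplus H → (y : X) ∉ Bplus H →
        (H.induce (B : Set X)ᶜ).pathDist x y ≤ ENNReal.ofReal t * edist (x : X) (y : X)) ∧
    ∑' H, D H * ((Bplus H).card : ℝ≥0∞) ≤ ENNReal.ofReal (1 + ν) * (B.card : ℝ≥0∞)

/-- The oblivious spanner `D` has (at most) `m` edges: every graph in its support has at most `m`
edges. -/
def HasAtMostEdges {X : Type*} (D : PMF (WeightedGraph X)) (m : ℝ) : Prop :=
  ∀ H ∈ D.support, (H.numEdges : ℝ) ≤ m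

/-!
The spanner is obtained by reducing the metric space to several copies of the line.

*Reduction to the line.* `exists_orderings` provides of order
`n ^ (1 / (2 * k)) * log n * (k / ε) * log (k / ε)`
numberings of `X` such that any two points `x`, `y` are close, in at least one of them, to
everything between them: `d(x, z) + d(z, y) ≤ (8k + ε) d(x, y)`. Each numbering lists the leaves of a
hierarchy of clusters, so that clusters are intervals. One level of a hierarchy comes from region
growing (`exists_clustering`): among pairs at distance at most `ρ`, one clustering of radius `κ * ρ`
joins a fraction `n ^ (-1 / κ)`, because the number of pairs inside a ball cannot grow by more than
the factor `n ^ (1 / κ)` at each of `κ` radii. With `κ = 2k`, all pairs are joined after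
`2 * n ^ (1 / κ) * log n` hierarchies. The next level clusters the centres of the previous one
(`exists_hierarchy`); if the scales increase by a factor of order `k ^ 2 / ε`, this costs
a factor `1 + O(ε / k)` only. The scales `(1 + η) ^ i` are thus distributed, according to `i` modulo
`m`, among `m` families of hierarchies. No bound depends on the number of levels.

*The line.* For every scale `s = 2 ^ j` and each block of `s` consecutive positions, `t` random
centres in the block are joined to all points of the neighbouring blocks. If `x < y` are two or
three blocks apart, a fault-free centre between `x` and the end of the block after that of `x`
connects them by two hops. The faulty extension consists of the `shadow`, the points to the right of
which some interval is almost entirely faulty, and of the points which miss all such centres. The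
shadow has at most `δ |B|` points (`card_le_of_subset_shadow`). The points of a block outside it
have distinct numbers of usable centres in front of them, at least of order `δ s`, so the
probabilities of a miss form the tail of a geometric series; with `t` of order `(1 + log log n) / δ`
their sum is at most the fraction `δ / log n` of the number of faults in the next block
(`sum_miss_probability_le`). Summing over blocks, scales and the `τ` numberings, and
taking `δ = ν / (2 * τ)`, the extension adds at most `ν |B|` points on average.
-/

/-! ### Clusterings and hierarchies -/

/-- Region growing: one clustering of radius `κ * ρ`, given by the map `g` from points to centres,
joins a fraction `q = n ^ (-1 / κ)` of any given family of pairs at distance at most `ρ`. -/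
lemma exists_clustering {ι X : Type*} [MetricSpace X] [Fintype X] [DecidableEq X]
    (a b : ι → X) {ρ q : ℝ} {κ : ℕ} (hρ : 0 ≤ ρ) (hκ : 1 ≤ κ) (hq : 0 ≤ q)
    (hqn : q ^ κ * Fintype.card X ≤ 1) (S : Finset ι) (hd : ∀ s ∈ S, dist (a s) (b s) ≤ ρ) :
    ∃ g : X → X, (∀ x, dist x (g x) ≤ κ * ρ) ∧
      q * S.card ≤ (S.filter fun s => g (a s) = g (b s)).card := by
  classical
  induction S using Finset.strongInduction with
  | H S ih =>
  rcases S.eq_empty_or_nonempty with rfl | hS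
  · exact ⟨id, fun x => by simp; positivity, by simp⟩
  set w : X → ℕ → Finset ι := fun u j =>
    S.filter fun s => dist (a s) u ≤ j * ρ ∧ dist (b s) u ≤ j * ρ with hw
  have hwS : ∀ u j, w u j ⊆ S := fun u j => Finset.filter_subset _ _
  -- Double counting pairs and centres: some ball of radius `ρ` contains `#S / n` pairs.
  obtain ⟨u, hu⟩ : ∃ u, S.card ≤ Fintype.card X * (w u 1).card := by
    by_contra! hcon
    obtain ⟨s₀, hs₀⟩ := hS
    have hne : (Finset.univ : Finset X).Nonempty := ⟨a s₀, Finset.mem_univ _⟩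
    have h1 : ∑ u : X, Fintype.card X * (w u 1).card < ∑ _u : X, S.card :=
      Finset.sum_lt_sum_of_nonempty hne fun u _ => hcon u
    have h2 : S.card ≤ ∑ u : X, (w u 1).card := by
      have : S ⊆ Finset.univ.biUnion fun u => w u 1 := by
        intro s hs
        simp only [Finset.mem_biUnion, Finset.mem_univ, true_and, hw, Finset.mem_filter]
        refine ⟨a s, hs, by simpa using hρ, ?_⟩
        rw [dist_comm]; simpa using hd s hs
      exact (Finset.card_le_card this).trans Finset.card_biUnion_le
    rw [← Finset.mul_sum] at h1
    simp only [Finset.sum_const, Finset.card_univ, smul_eq_mul] at h1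
    exact absurd h1 (not_lt.mpr (Nat.mul_le_mul_left _ h2))
  have hw1 : 0 < (w u 1).card := by
    rcases Nat.eq_zero_or_pos (w u 1).card with h | h
    · rw [h, mul_zero] at hu
      exact absurd hu (by simpa using hS.ne_empty)
    · exact h
  -- Among `κ` consecutive radii, one increases the number of captured pairs at most
  -- by the factor `1 / q` in the next step.
  obtain ⟨j, hj1, hjκ, hj⟩ : ∃ j, 1 ≤ j ∧ j ≤ κ ∧ q * (w u (j + 1)).card ≤ (w u j).card := by
    by_contra! hcon
    have key : ∀ i, i + 1 ≤ κ → ((w u 1).card : ℝ) < q ^ (i + 1) * (w u (i + 2)).card := by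
      intro i
      induction i with
      | zero => intro h; simpa using hcon 1 le_rfl h
      | succ i ihi =>
        intro h
        have h1 := ihi (by omega)
        have h2 := hcon (i + 2) (by omega) (by omega)
        calc ((w u 1).card : ℝ) < q ^ (i + 1) * (w u (i + 2)).card := h1
          _ ≤ q ^ (i + 1) * (q * (w u (i + 2 + 1)).card) := by gcongr
          _ = _ := by ring
    have h1 := key (κ - 1) (by omega)
    rw [Nat.sub_add_cancel hκ] at h1
    have h2 : ((w u (κ - 1 + 2)).card : ℝ) ≤ S.card := by
      exact_mod_cast Finset.card_le_card (hwS _ _)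
    have h3 : (S.card : ℝ) ≤ Fintype.card X * (w u 1).card := by exact_mod_cast hu
    have h4 : ((w u 1).card : ℝ) < (q ^ κ * Fintype.card X) * (w u 1).card :=
      calc ((w u 1).card : ℝ) < q ^ κ * (w u (κ - 1 + 2)).card := h1
        _ ≤ q ^ κ * (Fintype.card X * (w u 1).card) := by gcongr; exact h2.trans h3
        _ = _ := by ring
    have h5 : (q ^ κ * Fintype.card X) * ((w u 1).card : ℝ) ≤ 1 * (w u 1).card := by gcongr
    linarith
  set T := S.filter fun s => dist (a s) u ≤ j * ρ ∨ dist (b s) u ≤ j * ρ with hT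
  have hTS : T ⊆ S := Finset.filter_subset _ _
  have hTw : T ⊆ w u (j + 1) := by
    intro s hs
    simp only [hT, hw, Finset.mem_filter] at hs ⊢
    obtain ⟨hsS, hs⟩ := hs
    have h1 := hd s hsS
    have h2 := dist_triangle (a s) (b s) u
    have h3 := dist_triangle (b s) (a s) u
    rw [dist_comm (b s) (a s)] at h3
    push_cast
    refine ⟨hsS, ?_, ?_⟩ <;> rcases hs with hs | hs <;> nlinarith
  have hwT : w u j ⊆ T := by
    intro s hs
    simp only [hT, hw, Finset.mem_filter] at hs ⊢
    exact ⟨hs.1, Or.inl hs.2.1⟩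
  have hTne : T.Nonempty := by
    have h1 : w u 1 ⊆ w u j := by
      intro s hs
      simp only [hw, Finset.mem_filter] at hs ⊢
      have : ((1 : ℕ) : ℝ) * ρ ≤ j * ρ := by gcongr
      exact ⟨hs.1, hs.2.1.trans this, hs.2.2.trans this⟩
    exact (Finset.card_pos.mp hw1).mono (h1.trans hwT)
  obtain ⟨g, hg, hgS⟩ := ih (S \ T) (Finset.sdiff_ssubset hTS hTne)
    fun s hs => hd s (Finset.sdiff_subset hs)
  refine ⟨fun x => if dist x u ≤ j * ρ then u else g x, fun x => ?_, ?_⟩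
  · dsimp only
    split_ifs with h
    · exact h.trans (by gcongr)
    · exact hg x
  have hdis : Disjoint (w u j) ((S \ T).filter fun s => g (a s) = g (b s)) :=
    Finset.disjoint_of_subset_left hwT
      (Finset.disjoint_of_subset_right (Finset.filter_subset _ _) Finset.disjoint_sdiff)
  have hsub : w u j ∪ ((S \ T).filter fun s => g (a s) = g (b s)) ⊆ S.filter fun s =>
      (if dist (a s) u ≤ j * ρ then u else g (a s)) =
        (if dist (b s) u ≤ j * ρ then u else g (b s)) := by
    intro s hs
    rw [Finset.mem_union] at hs
    rcases hs with hs | hs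
    · simp only [hw, Finset.mem_filter] at hs ⊢
      exact ⟨hs.1, by rw [if_pos hs.2.1, if_pos hs.2.2]⟩
    · simp only [hT, Finset.mem_filter, Finset.mem_sdiff, not_and, not_or] at hs ⊢
      obtain ⟨⟨hsS, hs⟩, hgs⟩ := hs
      exact ⟨hsS, by rw [if_neg (hs hsS).1, if_neg (hs hsS).2, hgs]⟩
  have hcard := Finset.card_le_card hsub
  rw [Finset.card_union_of_disjoint hdis] at hcard
  have h1 : ((T.card : ℕ) : ℝ) ≤ (w u (j + 1)).card := by exact_mod_cast Finset.card_le_card hTw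
  have h2 : ((S \ T).card : ℝ) + T.card = S.card := by
    exact_mod_cast Finset.card_sdiff_add_card_eq_card hTS
  calc q * (S.card : ℝ) = q * T.card + q * (S \ T).card := by rw [← h2]; ring
    _ ≤ q * (w u (j + 1)).card + q * (S \ T).card := by gcongr
    _ ≤ (w u j).card + ((S \ T).filter fun s => g (a s) = g (b s)).card := add_le_add hj hgS
    _ ≤ _ := by exact_mod_cast hcard

/-- A sequence of partitions of `X`, each refining the next: the clusters of level `l` are the
fibres of `C l`, and `C l x` serves as the centre of the cluster of `x`. -/
def IsNested {X : Type*} (C : ℕ → X → X) : Prop :=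
  ∀ l x y, C l x = C l y → C (l + 1) x = C (l + 1) y

lemma IsNested.mono {X : Type*} {C : ℕ → X → X} (hC : IsNested C) {l m : ℕ} (h : l ≤ m) {x y : X}
    (hxy : C l x = C l y) : C m x = C m y := by
  induction m, h using Nat.le_induction with
  | base => exact hxy
  | succ m _ ih => exact hC m x y ih

/-- Region growing on every scale, applied on each level to the centres of the level below. The
scales increase so fast that the displacement of the centres is negligible. -/
lemma exists_hierarchy {X : Type*} [MetricSpace X] [Fintype X] [DecidableEq X]
    {σ : ℕ → ℝ} {η q : ℝ} {κ : ℕ}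
    (hσ : ∀ l, 0 < σ l) (hη : 0 ≤ η) (hσ' : ∀ l, 2 * (κ * (1 + 2 * η) * σ l) ≤ η * σ (l + 1))
    (hκ : 1 ≤ κ) (hq : 0 ≤ q) (hqn : q ^ κ * Fintype.card X ≤ 1) (S : ℕ → Finset (X × X))
    (hS : ∀ l, ∀ p ∈ S l, dist p.1 p.2 ≤ σ l) :
    ∃ C : ℕ → X → X, IsNested C ∧ (∀ l x, dist x (C l x) ≤ κ * (1 + 2 * η) * σ l) ∧
      ∀ l, q * (S l).card ≤ ((S l).filter fun p => C l p.1 = C l p.2).card := by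
  have hκ' : (1 : ℝ) ≤ κ := by exact_mod_cast hκ
  have step : ∀ (l : ℕ) (f : X → X), ∃ f' : X → X, (∀ x y, f x = f y → f' x = f' y) ∧
      ((∀ x, 2 * dist x (f x) ≤ η * σ l) → (∀ x, dist x (f' x) ≤ κ * (1 + 2 * η) * σ l) ∧
        q * (S l).card ≤ ((S l).filter fun p => f' p.1 = f' p.2).card) := by
    intro l f
    have hσl := (hσ l).le
    by_cases hf : ∀ x, 2 * dist x (f x) ≤ η * σ l
    swap
    · exact ⟨f, fun _ _ h => h, fun h => absurd h hf⟩
    obtain ⟨g, hg, hgS⟩ := exists_clustering (fun p : X × X => f p.1) (fun p => f p.2)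
      (ρ := (1 + η) * σ l) (by positivity) hκ hq hqn (S l) (fun p hp => by
        have h1 := dist_triangle4 (f p.1) p.1 p.2 (f p.2)
        rw [dist_comm (f p.1) p.1] at h1
        linarith [hf p.1, hf p.2, hS l p hp])
    refine ⟨g ∘ f, fun x y h => by simp [h], fun _ => ⟨fun x => ?_, ?_⟩⟩
    · have h1 := dist_triangle x (f x) (g (f x))
      have h2 := hg (f x)
      have h3 : 0 ≤ (κ - 1 : ℝ) * (η * σ l) := by
        have : (0 : ℝ) ≤ κ - 1 := by linarith
        positivity
      have h4 := hf x
      have h5 : 0 ≤ dist x (f x) := dist_nonneg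
      simp only [Function.comp]
      nlinarith
    · exact hgS
  choose F hF1 hF2 using step
  obtain ⟨C, hC0, hCs⟩ : ∃ C : ℕ → X → X, C 0 = F 0 id ∧ ∀ l, C (l + 1) = F (l + 1) (C l) :=
    ⟨fun l => Nat.rec (F 0 id) (fun l f => F (l + 1) f) l, rfl, fun _ => rfl⟩
  have main : ∀ l : ℕ, (∀ x : X, dist x (C l x) ≤ κ * (1 + 2 * η) * σ l) ∧
      q * (S l).card ≤ ((S l).filter fun p => C l p.1 = C l p.2).card := by
    intro l
    induction l with
    | zero =>
      rw [hC0]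
      refine hF2 0 id fun x => ?_
      have := (hσ 0).le
      simp only [id, dist_self, mul_zero]
      positivity
    | succ l ih =>
      rw [hCs]
      exact hF2 (l + 1) (C l) fun x => by linarith [ih.1 x, hσ' l]
  refine ⟨C, fun l x y h => ?_, fun l => (main l).1, fun l => (main l).2⟩
  rw [hCs]
  exact hF1 _ _ _ _ h

/-- As each hierarchy joins a fraction `q` of the remaining pairs on every level, `h` of them join
all pairs as soon as `(1 - q) ^ h * n ^ 2 < 1`. -/
lemma exists_hierarchy_family {X : Type*} [MetricSpace X] [Fintype X] {σ : ℕ → ℝ} {η q : ℝ}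
    {κ h : ℕ} (hσ : ∀ l, 0 < σ l) (hη : 0 ≤ η)
    (hσ' : ∀ l, 2 * (κ * (1 + 2 * η) * σ l) ≤ η * σ (l + 1))
    (hκ : 1 ≤ κ) (hq : 0 ≤ q) (hq1 : q ≤ 1) (hqn : q ^ κ * Fintype.card X ≤ 1)
    (hh : (1 - q) ^ h * (Fintype.card X : ℝ) ^ 2 < 1) :
    ∃ C : Fin h → ℕ → X → X, (∀ i, IsNested (C i)) ∧
      (∀ i l x, dist x (C i l x) ≤ κ * (1 + 2 * η) * σ l) ∧
      ∀ l x y, dist x y ≤ σ l → ∃ i, C i l x = C i l y := by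
  classical
  have ex : ∀ S : ℕ → Finset (X × X), ∃ C : ℕ → X → X, IsNested C ∧
      (∀ l x, dist x (C l x) ≤ κ * (1 + 2 * η) * σ l) ∧
      ((∀ l, ∀ p ∈ S l, dist p.1 p.2 ≤ σ l) →
        ∀ l, q * (S l).card ≤ ((S l).filter fun p => C l p.1 = C l p.2).card) := by
    intro S
    by_cases hS : ∀ l, ∀ p ∈ S l, dist p.1 p.2 ≤ σ l
    · obtain ⟨C, h1, h2, h3⟩ := exists_hierarchy hσ hη hσ' hκ hq hqn S hS
      exact ⟨C, h1, h2, fun _ => h3⟩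
    · obtain ⟨C, h1, h2, -⟩ := exists_hierarchy hσ hη hσ' hκ hq hqn (fun _ => ∅) (by simp)
      exact ⟨C, h1, h2, fun h => absurd h hS⟩
  choose G hG1 hG2 hG3 using ex
  -- `R i l` holds the pairs of level `l` which the first `i` hierarchies leave separated.
  let R : ℕ → ℕ → Finset (X × X) := fun i => Nat.rec
    (fun l => Finset.univ.filter fun p : X × X => dist p.1 p.2 ≤ σ l)
    (fun _ S l => (S l).filter fun p => ¬ G S l p.1 = G S l p.2) i
  have hRs : ∀ i l, R (i + 1) l = (R i l).filter fun p => ¬ G (R i) l p.1 = G (R i) l p.2 :=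
    fun _ _ => rfl
  have hRd : ∀ i l, ∀ p ∈ R i l, dist p.1 p.2 ≤ σ l := by
    intro i
    induction i with
    | zero => intro l p hp; exact (Finset.mem_filter.mp hp).2
    | succ i ih => intro l p hp; rw [hRs] at hp; exact ih l p (Finset.mem_filter.mp hp).1
  have hRc : ∀ i l, ((R i l).card : ℝ) ≤ (1 - q) ^ i * (Fintype.card X : ℝ) ^ 2 := by
    intro i l
    induction i with
    | zero =>
      have := Finset.card_le_univ (R 0 l)
      rw [Fintype.card_prod] at this
      rw [pow_zero, one_mul, sq]
      exact_mod_cast this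
    | succ i ih =>
      have h1 := Finset.card_filter_add_card_filter_not (s := R i l)
        (fun p => G (R i) l p.1 = G (R i) l p.2)
      rw [← hRs] at h1
      have h1' : (((R i l).filter fun p => G (R i) l p.1 = G (R i) l p.2).card : ℝ) +
          (R (i + 1) l).card = (R i l).card := by exact_mod_cast h1
      have h2 := hG3 (R i) (hRd i) l
      calc ((R (i + 1) l).card : ℝ) ≤ (1 - q) * (R i l).card := by linarith
        _ ≤ (1 - q) * ((1 - q) ^ i * (Fintype.card X : ℝ) ^ 2) :=
            mul_le_mul_of_nonneg_left ih (by linarith)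
        _ = _ := by ring
  refine ⟨fun i => G (R i), fun i => hG1 _, fun i => hG2 _, fun l x y hxy => ?_⟩
  by_contra! hcon
  have hmem : ∀ i, i ≤ h → (x, y) ∈ R i l := by
    intro i
    induction i with
    | zero => intro _; exact Finset.mem_filter.mpr ⟨Finset.mem_univ _, hxy⟩
    | succ i ih =>
      intro hi
      rw [hRs]
      exact Finset.mem_filter.mpr ⟨ih (by omega), hcon ⟨i, by omega⟩⟩
  have h1 : 1 ≤ (R h l).card := Finset.card_pos.mpr ⟨_, hmem h le_rfl⟩
  have h2 : (1 : ℝ) ≤ (R h l).card := by exact_mod_cast h1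
  linarith [hRc h l]

/-! ### Numberings in which close points have only close points between them -/

/-- A numbering of the leaves of a hierarchy for which clusters are intervals: points are compared
lexicographically by their clusters, the coarsest level coming first. -/
lemma exists_injective_key {X : Type*} [Fintype X] {C : ℕ → X → X} (hC : IsNested C) (L : ℕ) :
    ∃ key : X → ℕ, Function.Injective key ∧ ∀ l < L, ∀ x y z, C l x = C l y →
      key x ≤ key z → key z ≤ key y → C l z = C l x := by
  classical
  let e := Fintype.equivFin X
  induction L with
  | zero => exact ⟨fun x => e x, fun x y h => e.injective (Fin.ext h), by simp⟩
  | succ L ih =>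
    obtain ⟨key, hinj, hkey⟩ := ih
    obtain ⟨N, hN⟩ : ∃ N, ∀ x, key x < N :=
      ⟨Finset.univ.sup key + 1, fun x => Nat.lt_succ_of_le (Finset.le_sup (Finset.mem_univ x))⟩
    have hlex : ∀ x y, N * (e (C L x) : ℕ) + key x ≤ N * (e (C L y) : ℕ) + key y →
        (e (C L x) : ℕ) ≤ e (C L y) := by
      intro x y h
      by_contra! hlt
      have : N * ((e (C L y) : ℕ) + 1) ≤ N * (e (C L x) : ℕ) := Nat.mul_le_mul_left _ hlt
      have := hN y
      rw [Nat.mul_succ] at *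
      omega
    refine ⟨fun x => N * (e (C L x) : ℕ) + key x, fun x y h => ?_, ?_⟩
    · have h1 : (e (C L x) : ℕ) = e (C L y) := le_antisymm (hlex x y h.le) (hlex y x h.ge)
      simp only [h1] at h
      exact hinj (by omega)
    · intro l hl x y z hxy hxz hzy
      have hL : C L x = C L y := hC.mono (Nat.lt_succ_iff.mp hl) hxy
      have h1 := hlex x z hxz
      have h2 := hlex z y hzy
      rw [← hL] at h2
      have h3 : C L z = C L x := e.injective (Fin.ext (le_antisymm h2 h1))
      rcases (Nat.lt_succ_iff.mp hl).lt_or_eq with hl' | rfl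
      · simp only [h3, ← hL] at hxz hzy
        exact hkey l hl' x y z hxy (by omega) (by omega)
      · exact h3

lemma exists_convex_numbering {X : Type*} [Fintype X] {n : ℕ} (hn : Fintype.card X = n)
    {C : ℕ → X → X} (hC : IsNested C) (L : ℕ) :
    ∃ pos : X ≃ Fin n, ∀ l < L, ∀ x y z, C l x = C l y → pos x ≤ pos z → pos z ≤ pos y →
      C l z = C l x := by
  obtain ⟨key, hinj, hkey⟩ := exists_injective_key hC L
  let _ : LinearOrder X := LinearOrder.lift' key hinj
  let e := Fintype.orderIsoFinOfCardEq X hn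
  exact ⟨e.symm.toEquiv, fun l hl x y z hxy hxz hzy =>
    hkey l hl x y z hxy (e.symm.le_iff_le.mp hxz) (e.symm.le_iff_le.mp hzy)⟩

lemma exists_pos_le_dist (X : Type*) [MetricSpace X] [Finite X] :
    ∃ δ : ℝ, 0 < δ ∧ ∀ x y : X, x ≠ y → δ ≤ dist x y := by
  obtain ⟨M, hM⟩ := (Set.finite_range fun p : X × X => (dist p.1 p.2)⁻¹).bddAbove
  refine ⟨(max M 1)⁻¹, by positivity, fun x y hxy => ?_⟩
  have h1 : (dist x y)⁻¹ ≤ max M 1 := (hM ⟨(x, y), rfl⟩).trans (le_max_left _ _)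
  exact inv_le_of_inv_le₀ (dist_pos.mpr hxy) h1

/-- The scale `δ * (1 + η) ^ (i + 1)` belongs to level `i / m` of the family with index `i % m`. -/
lemma exists_orderings_of_scales {X : Type*} [MetricSpace X] [Fintype X] {η q : ℝ}
    {n κ h m : ℕ} (hn : Fintype.card X = n) (hη : 0 < η)
    (hm : 2 * (κ * (1 + 2 * η)) ≤ η * (1 + η) ^ m) (hm0 : 0 < m)
    (hκ : 1 ≤ κ) (hq : 0 ≤ q) (hq1 : q ≤ 1) (hqn : q ^ κ * n ≤ 1)
    (hh : (1 - q) ^ h * (n : ℝ) ^ 2 < 1) :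
    ∃ pos : Fin m × Fin h → X ≃ Fin n, ∀ x y, x ≠ y → ∃ a, ∀ z,
      pos a z ∈ Set.uIcc (pos a x) (pos a y) →
        dist x z + dist z y ≤ 4 * κ * (1 + 2 * η) * (1 + η) * dist x y := by
  obtain ⟨δ, hδ, hδX⟩ := exists_pos_le_dist X
  -- Every distance is within a factor `1 + η` below the scale `δ * (1 + η) ^ (i + 1)`, some `i`.
  have hscale : ∀ x y : X, ∃ i : ℕ, x ≠ y →
      dist x y ≤ δ * (1 + η) ^ (i + 1) ∧ δ * (1 + η) ^ (i + 1) ≤ (1 + η) * dist x y := by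
    intro x y
    by_cases hxy : x = y
    · exact ⟨0, fun h => absurd hxy h⟩
    obtain ⟨i, hi1, hi2⟩ := exists_nat_pow_near (x := dist x y / δ) (y := 1 + η)
      ((one_le_div hδ).mpr (hδX x y hxy)) (by linarith)
    rw [le_div_iff₀ hδ] at hi1
    rw [div_lt_iff₀ hδ] at hi2
    refine ⟨i, fun _ => ⟨by linarith, ?_⟩⟩
    have : (1 + η) * ((1 + η) ^ i * δ) ≤ (1 + η) * dist x y := by gcongr
    rw [pow_succ]
    linarith
  choose lev hlev using hscale
  obtain ⟨L, hL⟩ : ∃ L, ∀ x y, lev x y < L :=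
    ⟨Finset.univ.sup (fun p : X × X => lev p.1 p.2) + 1, fun x y => Nat.lt_succ_of_le
      (Finset.le_sup (f := fun p : X × X => lev p.1 p.2) (Finset.mem_univ (x, y)))⟩
  have hfam : ∀ o : Fin m, ∃ C : Fin h → ℕ → X → X, (∀ i, IsNested (C i)) ∧
      (∀ i l x, dist x (C i l x) ≤ κ * (1 + 2 * η) * (δ * (1 + η) ^ (m * l + o + 1))) ∧
      ∀ l x y, dist x y ≤ δ * (1 + η) ^ (m * l + o + 1) → ∃ i, C i l x = C i l y := by
    intro o
    refine exists_hierarchy_family (fun l => by positivity) hη.le (fun l => ?_) hκ hq hq1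
      (by rwa [hn]) (by rwa [hn])
    have : δ * (1 + η) ^ (m * (l + 1) + o + 1) = (1 + η) ^ m * (δ * (1 + η) ^ (m * l + o + 1)) := by
      ring
    rw [this, ← mul_assoc η, ← mul_assoc 2]
    gcongr
  choose C hC1 hC2 hC3 using hfam
  choose pos hpos using fun a : Fin m × Fin h => exists_convex_numbering hn (hC1 a.1 a.2) L
  refine ⟨pos, fun x y hxy => ?_⟩
  obtain ⟨h1, h2⟩ := hlev x y hxy
  obtain ⟨i, hi⟩ := hC3 ⟨lev x y % m, Nat.mod_lt _ hm0⟩ (lev x y / m) x y (by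
    simpa only [Nat.div_add_mod] using h1)
  have hCd := hC2 ⟨lev x y % m, Nat.mod_lt _ hm0⟩ i (lev x y / m)
  have hcv := hpos (⟨lev x y % m, Nat.mod_lt _ hm0⟩, i) (lev x y / m)
    ((Nat.div_le_self _ _).trans_lt (hL x y))
  simp only [Nat.div_add_mod] at hCd
  refine ⟨(⟨lev x y % m, Nat.mod_lt _ hm0⟩, i), fun z hz => ?_⟩
  set f := C ⟨lev x y % m, Nat.mod_lt _ hm0⟩ i (lev x y / m)
  have hz' : f z = f x := by
    rw [Set.mem_uIcc] at hz
    rcases hz with hz | hz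
    · exact hcv x y z hi hz.1 hz.2
    · exact (hcv y x z hi.symm hz.1 hz.2).trans hi.symm
  have hx := dist_triangle_right x z (f x)
  have hy := dist_triangle_right z y (f x)
  have hdx := hCd x
  have hdz := hCd z
  have hdy := hCd y
  rw [hz'] at hdz
  rw [← hi] at hdy
  have : κ * (1 + 2 * η) * (δ * (1 + η) ^ (lev x y + 1)) ≤
      κ * (1 + 2 * η) * ((1 + η) * dist x y) := by gcongr
  linarith

/-- A family of `τ` numberings of `X` which reduces spanners of `X` to spanners of the line: any two
points are close, in one of the numberings, to everything between them. -/
lemma exists_orderings : ∃ C₁ : ℝ, 0 < C₁ ∧ ∀ (X : Type*) [MetricSpace X] [Fintype X] (n : ℕ),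
    Fintype.card X = n → 2 ≤ n → ∀ (ε : ℝ) (k : ℕ), 0 < ε → ε < 1 / 2 → 1 ≤ k →
    ∃ (τ : ℕ) (pos : Fin τ → X ≃ Fin n),
      (τ : ℝ) ≤ C₁ * (k / ε * Real.log (k / ε)) * (n : ℝ) ^ (1 / (2 * k) : ℝ) * Real.log n ∧
      ∀ x y, x ≠ y → ∃ a, ∀ z, pos a z ∈ Set.uIcc (pos a x) (pos a y) →
        dist x z + dist z y ≤ (8 * k + ε) * dist x y := by
  refine ⟨2000 * 5, by norm_num, fun X _ _ n hn hn2 ε k hε hε2 hk => ?_⟩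
  have hk' : (1 : ℝ) ≤ k := by exact_mod_cast hk
  have hn' : (2 : ℝ) ≤ n := by exact_mod_cast hn2
  have hl2 := Real.log_two_gt_d9
  have hln : 0.69 ≤ Real.log n := by
    have := Real.log_le_log (by norm_num) hn'
    linarith
  have hkε : 2 ≤ (k : ℝ) / ε := by
    rw [le_div_iff₀ hε]; linarith
  have hlk : 0.69 ≤ Real.log (k / ε) := by
    have := Real.log_le_log (by norm_num) hkε
    linarith
  set Q : ℝ := (n : ℝ) ^ (1 / (2 * k) : ℝ) with hQ
  have hQ1 : 1 ≤ Q := Real.one_le_rpow (by linarith) (by positivity)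
  have hQn : Q ^ (2 * k) = n := by
    rw [hQ, ← Real.rpow_natCast, ← Real.rpow_mul (by linarith)]
    push_cast
    rw [one_div_mul_cancel (by positivity), Real.rpow_one]
  set η : ℝ := ε / (40 * k) with hη
  have hη0 : 0 < η := by positivity
  have hη1 : η ≤ 1 / 80 := by
    rw [hη, div_le_iff₀ (by positivity)]; linarith
  set m := ⌈2 / η * Real.log (8 * k / η)⌉₊ with hm
  set h := ⌈2 * Q * Real.log n⌉₊ + 1 with hh
  have h8 : 1 < 8 * k / η := by
    rw [lt_div_iff₀ hη0]; linarith
  have hm1 : 8 * k / η ≤ (1 + η) ^ m := by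
    rw [← Real.log_le_log_iff (by positivity) (by positivity), Real.log_pow]
    have h1 : η / 2 ≤ Real.log (1 + η) := by
      have h2 := Real.one_sub_inv_le_log_of_pos (x := 1 + η) (by linarith)
      have h3 : η / 2 ≤ 1 - (1 + η)⁻¹ := by
        rw [le_sub_iff_add_le, ← le_sub_iff_add_le', inv_le_iff_one_le_mul₀ (by linarith)]
        nlinarith
      linarith
    have h2 := Nat.le_ceil (2 / η * Real.log (8 * k / η))
    rw [← hm] at h2
    calc Real.log (8 * k / η) = 2 / η * Real.log (8 * k / η) * (η / 2) := by field_simp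
      _ ≤ m * Real.log (1 + η) := by gcongr
  have hm0 : 0 < m := Nat.ceil_pos.mpr (mul_pos (by positivity) (Real.log_pos h8))
  have hpw : (1 - Q⁻¹) ^ h * (n : ℝ) ^ 2 < 1 := by
    have h1 : 1 - Q⁻¹ ≤ Real.exp (-Q⁻¹) := Real.one_sub_le_exp_neg _
    have h0 : 0 ≤ 1 - Q⁻¹ := sub_nonneg.mpr (inv_le_one_of_one_le₀ hQ1)
    have h2 : (n : ℝ) ^ 2 = Real.exp (2 * Real.log n) := by
      rw [two_mul, Real.exp_add, Real.exp_log (by linarith), sq]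
    calc (1 - Q⁻¹) ^ h * (n : ℝ) ^ 2 ≤ Real.exp (-Q⁻¹) ^ h * (n : ℝ) ^ 2 := by gcongr
      _ = Real.exp (h * -Q⁻¹ + 2 * Real.log n) := by
        rw [h2, ← Real.exp_nat_mul, ← Real.exp_add]
      _ < 1 := by
        rw [Real.exp_lt_one_iff]
        have h3 := Nat.le_ceil (2 * Q * Real.log n)
        have h4 : 2 * Q * Real.log n < h := by rw [hh]; push_cast; linarith
        have h5 : 2 * Q * Real.log n * Q⁻¹ < h * Q⁻¹ := by gcongr
        have h6 : 2 * Q * Real.log n * Q⁻¹ = 2 * Real.log n := by field_simp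
        linarith
  obtain ⟨pos, hpos⟩ := exists_orderings_of_scales (κ := 2 * k) (h := h) (m := m) (η := η)
    (q := Q⁻¹) hn hη0 (by
      rw [div_le_iff₀ hη0] at hm1
      push_cast
      nlinarith) hm0 (by omega) (by positivity) (inv_le_one_of_one_le₀ hQ1)
      (by rw [inv_pow, hQn, inv_mul_cancel₀ (by positivity)]) hpw
  refine ⟨m * h, fun a => pos (finProdFinEquiv.symm a), ?_, fun x y hxy => ?_⟩
  · have hmb : (m : ℝ) ≤ 2000 * (k / ε * Real.log (k / ε)) := by
      have h1 := Nat.ceil_lt_add_one (a := 2 / η * Real.log (8 * k / η))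
        (mul_nonneg (by positivity) (Real.log_nonneg h8.le))
      rw [← hm] at h1
      have h2 : 2 / η = 80 * (k / ε) := by rw [hη]; field_simp; norm_num
      have h3 : 8 * k / η ≤ 2 ^ 9 * (k / ε) ^ 2 := by
        rw [hη]
        field_simp
        nlinarith
      have h4 : Real.log (8 * k / η) ≤ 9 * Real.log 2 + 2 * Real.log (k / ε) := by
        have := Real.log_le_log (by positivity) h3
        rw [Real.log_mul (by norm_num) (by positivity), Real.log_pow, Real.log_pow] at this
        exact_mod_cast this
      have h5 := Real.log_le_log (by norm_num) hkε
      rw [h2] at h1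
      have h6 : 80 * (k / ε) * Real.log (8 * k / η) ≤
          80 * (k / ε) * (11 * Real.log (k / ε)) := by gcongr; linarith
      have h7 : 2 * 0.69 ≤ k / ε * Real.log (k / ε) := by gcongr
      nlinarith
    have hhb : (h : ℝ) ≤ 5 * (Q * Real.log n) := by
      have h1 := Nat.ceil_lt_add_one (a := 2 * Q * Real.log n) (by positivity)
      have h2 : 1 * 0.69 ≤ Q * Real.log n := by gcongr
      rw [hh]
      push_cast
      linarith
    push_cast
    calc (m : ℝ) * h ≤ 2000 * (k / ε * Real.log (k / ε)) * (5 * (Q * Real.log n)) := by gcongr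
      _ = _ := by ring
  · obtain ⟨a, ha⟩ := hpos x y hxy
    refine ⟨finProdFinEquiv a, fun z hz => ?_⟩
    simp only [Equiv.symm_apply_apply] at hz
    refine (ha z hz).trans ?_
    have : 4 * ((2 * k : ℕ) : ℝ) * (1 + 2 * η) * (1 + η) ≤ 8 * k + ε := by
      have h1 : ε = 40 * k * η := by rw [hη]; field_simp
      push_cast
      rw [h1]
      nlinarith [mul_pos (mul_pos (by positivity : (0 : ℝ) < k) hη0) hη0]
    gcongr

/-! ### Faults on the line -/

/-- The points outside `B` from which some interval to the right contains, up to the factor `δ`,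
no more points outside `B` than points of `B`. -/
def shadow (B : Finset ℕ) (δ : ℝ) : Set ℕ :=
  {x | x ∉ B ∧ ∃ e, x < e ∧ ((Finset.Ico x e \ B).card : ℝ) ≤ δ * (Finset.Ico x e ∩ B).card}

lemma card_le_of_subset_shadow {B S : Finset ℕ} {δ : ℝ} (hδ : 0 ≤ δ)
    (hS : (S : Set ℕ) ⊆ shadow B δ) : (S.card : ℝ) ≤ δ * B.card := by
  -- Sweep from left to right, jumping over the interval which witnesses a point of the shadow.
  have key : ∀ d a N, (∀ x ∈ S, x < N) → N - a ≤ d →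
      ((S.filter (a ≤ ·)).card : ℝ) ≤ δ * (B.filter (a ≤ ·)).card := by
    intro d
    induction d with
    | zero =>
      intro a N hN ha
      rw [Finset.filter_false_of_mem fun x hx => by have := hN x hx; omega]
      simp only [Finset.card_empty, Nat.cast_zero]
      positivity
    | succ d ih =>
      intro a N hN ha
      by_cases haS : a ∈ S
      · obtain ⟨-, e, hae, he⟩ := hS haS
        have h1 := ih e N hN (by omega)
        have h2 : S.filter (a ≤ ·) ⊆ (Finset.Ico a e \ B) ∪ S.filter (e ≤ ·) := by
          intro x hx
          simp only [Finset.mem_union, Finset.mem_filter, Finset.mem_sdiff, Finset.mem_Ico] at hx ⊢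
          by_cases hxe : e ≤ x
          · exact Or.inr ⟨hx.1, hxe⟩
          · exact Or.inl ⟨⟨hx.2, by omega⟩, (hS hx.1).1⟩
        have h3 : (Finset.Ico a e ∩ B) ∪ B.filter (e ≤ ·) ⊆ B.filter (a ≤ ·) := by
          intro x hx
          simp only [Finset.mem_union, Finset.mem_filter, Finset.mem_inter, Finset.mem_Ico] at hx ⊢
          rcases hx with hx | hx
          · exact ⟨hx.2, hx.1.1⟩
          · exact ⟨hx.1, by omega⟩
        have h4 : Disjoint (Finset.Ico a e ∩ B) (B.filter (e ≤ ·)) := by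
          rw [Finset.disjoint_left]
          intro x hx hx'
          simp only [Finset.mem_filter, Finset.mem_inter, Finset.mem_Ico] at hx hx'
          omega
        have h2' := (Finset.card_le_card h2).trans (Finset.card_union_le _ _)
        have h3' := Finset.card_le_card h3
        rw [Finset.card_union_of_disjoint h4] at h3'
        calc ((S.filter (a ≤ ·)).card : ℝ)
            ≤ (Finset.Ico a e \ B).card + (S.filter (e ≤ ·)).card := by exact_mod_cast h2'
          _ ≤ δ * (Finset.Ico a e ∩ B).card + δ * (B.filter (e ≤ ·)).card := add_le_add he h1
          _ = δ * ((Finset.Ico a e ∩ B).card + (B.filter (e ≤ ·)).card : ℕ) := by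
            push_cast; ring
          _ ≤ _ := by gcongr
      · have h1 : S.filter (a ≤ ·) = S.filter (a + 1 ≤ ·) := by
          refine Finset.filter_congr fun x hx => ⟨fun h => ?_, fun h => by omega⟩
          exact Nat.lt_of_le_of_ne h fun h' => haS (h' ▸ hx)
        have h2 : B.filter (a + 1 ≤ ·) ⊆ B.filter (a ≤ ·) :=
          Finset.monotone_filter_right _ fun x _ h => Nat.le_of_succ_le h
        rw [h1]
        refine (ih (a + 1) N hN (by omega)).trans ?_
        gcongr
  have := key _ 0 (S.sup id + 1)
    (fun x hx => Nat.lt_succ_of_le (Finset.le_sup (f := id) hx)) le_rfl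
  simpa using this

lemma sum_exp_neg_le {c : ℝ} (hc : 0 < c) (N : Finset ℕ) (hN : ∀ i ∈ N, 1 ≤ i) :
    ∑ i ∈ N, Real.exp (-(c * i)) ≤ 1 / c := by
  set y := Real.exp (-c) with hy
  have hy1 : y < 1 := by rw [hy, Real.exp_lt_one_iff]; linarith
  have hy0 : 0 < y := Real.exp_pos _
  have hsub : N ⊆ (Finset.range (N.sup id)).image (· + 1) := by
    intro i hi
    have h1 := hN i hi
    have h2 : i ≤ N.sup id := Finset.le_sup (f := id) hi
    exact Finset.mem_image.mpr ⟨i - 1, Finset.mem_range.mpr (by omega), by omega⟩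
  have hpow : ∀ i : ℕ, Real.exp (-(c * i)) = y ^ i := fun i => by
    rw [hy, ← Real.exp_nat_mul]; ring_nf
  calc ∑ i ∈ N, Real.exp (-(c * i))
      ≤ ∑ i ∈ (Finset.range (N.sup id)).image (· + 1), Real.exp (-(c * (i : ℕ))) :=
        Finset.sum_le_sum_of_subset_of_nonneg hsub fun _ _ _ => (Real.exp_pos _).le
    _ = y * ∑ i ∈ Finset.range (N.sup id), y ^ i := by
        rw [Finset.sum_image fun a _ b _ h => Nat.succ_injective h, Finset.mul_sum]
        exact Finset.sum_congr rfl fun i _ => by rw [hpow, pow_succ']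
    _ ≤ y * (1 - y)⁻¹ := by
        gcongr
        exact (Summable.sum_le_tsum _ (fun i _ => by positivity)
          (summable_geometric_of_lt_one hy0.le hy1)).trans_eq (tsum_geometric_of_lt_one hy0.le hy1)
    _ ≤ 1 / c := by
        rw [← div_eq_mul_inv, div_le_div_iff₀ (by linarith) hc]
        have h1 := Real.add_one_le_exp c
        have h2 : Real.exp c * y = 1 := by rw [hy, ← Real.exp_add, add_neg_cancel, Real.exp_zero]
        nlinarith

/-- The expected number of points of a block of length `s` for which all the centres sampled to
their right are faulty, when `t` centres are sampled from the block and `t` from the next one. Here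
`u x` counts the usable centres in the block of `x` and `β` the faulty ones in the next block. -/
lemma sum_miss_probability_le {s t β : ℕ} {δ K : ℝ} (hs : 0 < s) (hδ : 0 < δ) (hδ1 : δ ≤ 1)
    (hK : 1 ≤ K) (ht : 4 / δ * (1 + Real.log K) ≤ t) (hβ : β ≤ s) (T : Finset ℕ) (u : ℕ → ℕ)
    (hu : Set.InjOn u T) (hu1 : ∀ x ∈ T, 1 ≤ u x) (hus : ∀ x ∈ T, u x ≤ s)
    (hTs : T.card ≤ s) (hsh : ∀ x ∈ T, δ / 2 * s ≤ u x + (s - β : ℝ)) :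
    ∑ x ∈ T, ((1 - u x / s : ℝ) * (β / s)) ^ t ≤ δ / K * β := by
  have hs' : (0 : ℝ) < s := by exact_mod_cast hs
  have hlK : 0 ≤ Real.log K := Real.log_nonneg hK
  have ht4 : 4 / δ ≤ t := le_trans (by
    have : 0 < 4 / δ := by positivity
    nlinarith) ht
  have hδ4 : 4 ≤ 4 / δ := by rw [le_div_iff₀ hδ]; linarith
  have ht0 : (0 : ℝ) < t := by linarith
  have htn : 4 ≤ t := by exact_mod_cast (hδ4.trans ht4)
  have hexp : Real.exp (-(δ * t / 4)) ≤ 1 / K := by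
    have h1 : 1 + Real.log K ≤ δ * t / 4 := by
      rw [div_mul_eq_mul_div, div_le_iff₀ hδ] at ht
      linarith
    calc Real.exp (-(δ * t / 4)) ≤ Real.exp (-Real.log K) := by
          apply Real.exp_le_exp.mpr; linarith
      _ = 1 / K := by rw [Real.exp_neg, Real.exp_log (by linarith), one_div]
  have hus' : ∀ x ∈ T, 0 ≤ 1 - (u x / s : ℝ) := fun x hx => by
    rw [sub_nonneg, div_le_one hs']
    exact_mod_cast hus x hx
  by_cases hβs : s ≤ 2 * β
  · -- The numbers `u x` are distinct, so that the failure probabilities form a geometric series.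
    have hβs' : (s : ℝ) ≤ 2 * β := by exact_mod_cast hβs
    have hterm : ∀ x ∈ T, ((1 - u x / s : ℝ) * (β / s)) ^ t ≤
        Real.exp (-(δ * t / 4)) * Real.exp (-(t / (2 * s) * u x)) := by
      intro x hx
      have h1 : (1 - u x / s : ℝ) ≤ Real.exp (-(u x / s)) := Real.one_sub_le_exp_neg _
      have h2 : (β / s : ℝ) ≤ Real.exp (-((s - β) / s)) := by
        refine le_trans (le_of_eq ?_) (Real.one_sub_le_exp_neg ((s - β) / s : ℝ))
        field_simp
        ring
      calc ((1 - u x / s : ℝ) * (β / s)) ^ t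
          ≤ (Real.exp (-(u x / s)) * Real.exp (-((s - β) / s))) ^ t := by
            have := hus' x hx
            gcongr
        _ = Real.exp (-((u x + (s - β)) * (t / s))) := by
            rw [← Real.exp_add, ← Real.exp_nat_mul]
            congr 1
            field_simp
            ring
        _ ≤ Real.exp (-(δ * t / 4) + -(t / (2 * s) * u x)) := by
            apply Real.exp_le_exp.mpr
            have h3 := hsh x hx
            have h4 : (β : ℝ) ≤ s := by exact_mod_cast hβ
            have h5 : δ / 4 * s + u x / 2 ≤ u x + (s - β : ℝ) := by linarith
            have h6 : (δ / 4 * s + u x / 2) * (t / s : ℝ) ≤ (u x + (s - β : ℝ)) * (t / s) := by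
              gcongr
            have h7 : (δ / 4 * s + u x / 2) * (t / s : ℝ) = δ * t / 4 + t / (2 * s) * u x := by
              field_simp
            linarith
        _ = _ := Real.exp_add _ _
    calc ∑ x ∈ T, ((1 - u x / s : ℝ) * (β / s)) ^ t
        ≤ ∑ x ∈ T, Real.exp (-(δ * t / 4)) * Real.exp (-(t / (2 * s) * u x)) :=
          Finset.sum_le_sum hterm
      _ = Real.exp (-(δ * t / 4)) * ∑ i ∈ T.image u, Real.exp (-(t / (2 * s) * i)) := by
          rw [Finset.sum_image hu, Finset.mul_sum]
      _ ≤ 1 / K * (1 / (t / (2 * s))) := by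
          gcongr
          refine sum_exp_neg_le (by positivity) _ fun i hi => ?_
          obtain ⟨x, hx, rfl⟩ := Finset.mem_image.mp hi
          exact hu1 x hx
      _ ≤ 1 / K * (δ * β) := by
          gcongr
          rw [one_div_div, div_le_iff₀ ht0]
          rw [div_le_iff₀ hδ] at ht4
          nlinarith
      _ = _ := by ring
  · -- Most centres in the next block are usable, and the sample from it alone suffices.
    rw [not_le] at hβs
    have hhalf : (β / s : ℝ) ≤ 1 / 2 := by
      rw [div_le_div_iff₀ hs' (by norm_num)]
      have : (2 * β : ℝ) ≤ s := by exact_mod_cast hβs.le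
      linarith
    have hpow : (1 / 2 : ℝ) ^ (t - 1) ≤ δ / K := by
      rw [← Real.log_le_log_iff (by positivity) (by positivity), Real.log_pow,
        Real.log_div hδ.ne' (by positivity), one_div, Real.log_inv]
      have h1 := Real.log_two_gt_d9
      have h2 := Real.one_sub_inv_le_log_of_pos hδ
      have h3 : ((t - 1 : ℕ) : ℝ) = t - 1 := by
        rw [Nat.cast_sub (by omega), Nat.cast_one]
      have h4 : 4 / δ + 4 * Real.log K ≤ t := by
        calc 4 / δ + 4 * Real.log K ≤ 4 / δ + 4 / δ * Real.log K := by gcongr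
          _ = 4 / δ * (1 + Real.log K) := by ring
          _ ≤ t := ht
      have h5 : 4 / δ = 4 * δ⁻¹ := by ring
      rw [h5] at h4 hδ4
      rw [h3]
      have h6 : 0.69 * (t - 1 : ℝ) ≤ Real.log 2 * (t - 1 : ℝ) := by
        have : (0 : ℝ) ≤ t - 1 := by linarith
        gcongr
        linarith
      nlinarith
    calc ∑ x ∈ T, ((1 - u x / s : ℝ) * (β / s)) ^ t
        ≤ ∑ _x ∈ T, (β / s * (1 / 2) ^ (t - 1) : ℝ) := by
          refine Finset.sum_le_sum fun x hx => ?_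
          have h0 := hus' x hx
          have h1 : (1 - u x / s : ℝ) ≤ 1 := by
            have : (0 : ℝ) ≤ u x / s := by positivity
            linarith
          calc ((1 - u x / s : ℝ) * (β / s)) ^ t ≤ (1 * (β / s)) ^ t := by gcongr
            _ = (β / s) * (β / s) ^ (t - 1) := by
              rw [one_mul, ← pow_succ', Nat.sub_add_cancel (by omega)]
            _ ≤ _ := by gcongr
      _ = T.card * (β / s * (1 / 2) ^ (t - 1) : ℝ) := by rw [Finset.sum_const, nsmul_eq_mul]
      _ ≤ s * (β / s * (δ / K) : ℝ) := by gcongr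
      _ = _ := by field_simp

/-- Summed over all blocks of length `s`, the miss probabilities cost at most a `δ / K` fraction of
the number of faults, as each fault is charged by the single block on its left. -/
lemma sum_miss_probability_le_card {s t : ℕ} {δ K : ℝ} (hs : 0 < s) (hδ : 0 < δ) (hδ1 : δ ≤ 1)
    (hK : 1 ≤ K) (ht : 4 / δ * (1 + Real.log K) ≤ t) (B T : Finset ℕ)
    (hT : ∀ x ∈ T, x ∉ B ∧ x ∉ shadow B δ) :
    ∑ x ∈ T, ((1 - (Finset.Ico x ((x / s + 1) * s) \ B).card / s : ℝ) *
      ((B.filter fun z => z / s = x / s + 1).card / s)) ^ t ≤ δ / K * B.card := by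
  have hblock : ∀ x b, x / s = b ↔ b * s ≤ x ∧ x < (b + 1) * s := fun x b => by
    rw [← Nat.le_div_iff_mul_le hs, ← Nat.div_lt_iff_lt_mul hs]
    omega
  have hBb : ∀ b, B.filter (fun z => z / s = b + 1) =
      Finset.Ico ((b + 1) * s) ((b + 2) * s) ∩ B := fun b => by
    ext z
    simp only [Finset.mem_filter, Finset.mem_inter, Finset.mem_Ico, hblock]
    tauto
  have hfib : ∀ b ∈ T.image (· / s), ∑ x ∈ T with x / s = b,
      ((1 - (Finset.Ico x ((x / s + 1) * s) \ B).card / s : ℝ) *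
        ((B.filter fun z => z / s = x / s + 1).card / s)) ^ t ≤
      δ / K * (B.filter fun z => z / s = b + 1).card := by
    intro b _
    have hmem : ∀ x ∈ T.filter (· / s = b), x ∉ B ∧ x ∉ shadow B δ ∧ b * s ≤ x ∧
        x < (b + 1) * s := fun x hx => by
      rw [Finset.mem_filter, hblock] at hx
      exact ⟨(hT x hx.1).1, (hT x hx.1).2, hx.2⟩
    have hcard : (Finset.Ico ((b + 1) * s) ((b + 2) * s)).card = s := by
      rw [Nat.card_Ico, ← Nat.sub_mul]; simp
    rw [Finset.sum_congr rfl fun x hx => by rw [(Finset.mem_filter.mp hx).2]]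
    have hβ : (B.filter fun z => z / s = b + 1).card ≤ s := by
      rw [hBb]
      exact (Finset.card_le_card Finset.inter_subset_left).trans hcard.le
    refine sum_miss_probability_le hs hδ hδ1 hK ht hβ _
      (fun x => (Finset.Ico x ((b + 1) * s) \ B).card) ?_ ?_ ?_ ?_ ?_
    · have hlt : ∀ x ∈ T.filter (· / s = b), ∀ y, x < y →
          (Finset.Ico y ((b + 1) * s) \ B).card < (Finset.Ico x ((b + 1) * s) \ B).card := by
        intro x hx y hxy
        obtain ⟨h1, -, -, h2⟩ := hmem x hx
        refine Finset.card_lt_card (Finset.ssubset_iff_of_subset ?_ |>.mpr ⟨x, ?_, ?_⟩)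
        · exact Finset.sdiff_subset_sdiff (Finset.Ico_subset_Ico_left hxy.le) le_rfl
        · simp [h1, h2]
        · simp [hxy]
      intro x hx y hy hxy
      rcases lt_trichotomy x y with h | h | h
      · exact absurd hxy (hlt x hx y h).ne'
      · exact h
      · exact absurd hxy (hlt y hy x h).ne
    · intro x hx
      obtain ⟨h1, -, -, h2⟩ := hmem x hx
      exact Finset.card_pos.mpr ⟨x, by simp [h1, h2]⟩
    · intro x hx
      obtain ⟨-, -, h1, -⟩ := hmem x hx
      refine (Finset.card_le_card Finset.sdiff_subset).trans ?_
      rw [Nat.card_Ico, add_mul]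
      omega
    · refine (Finset.card_le_card (t := Finset.Ico (b * s) ((b + 1) * s)) fun x hx => ?_).trans ?_
      · exact Finset.mem_Ico.mpr (hmem x hx).2.2
      · rw [Nat.card_Ico, add_mul]
        omega
    · intro x hx
      obtain ⟨h1, h2, -, h3⟩ := hmem x hx
      have he : (b + 2) * s = (b + 1) * s + s := by ring
      have hG : ¬ ((Finset.Ico x ((b + 2) * s) \ B).card : ℝ) ≤
          δ * (Finset.Ico x ((b + 2) * s) ∩ B).card := fun h => h2 ⟨h1, _, by omega, h⟩
      rw [not_le] at hG
      have hGF := Finset.card_sdiff_add_card_inter (Finset.Ico x ((b + 2) * s)) B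
      rw [Nat.card_Ico] at hGF
      have hGF' : (s : ℝ) ≤ (Finset.Ico x ((b + 2) * s) \ B).card +
          (Finset.Ico x ((b + 2) * s) ∩ B).card := by
        have : s ≤ (Finset.Ico x ((b + 2) * s) \ B).card +
          (Finset.Ico x ((b + 2) * s) ∩ B).card := by omega
        exact_mod_cast this
      have hsplit : (Finset.Ico x ((b + 2) * s) \ B) = (Finset.Ico x ((b + 1) * s) \ B) ∪
          (Finset.Ico ((b + 1) * s) ((b + 2) * s) \ B) := by
        rw [← Finset.union_sdiff_distrib, Finset.Ico_union_Ico_eq_Ico h3.le (by omega)]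
      have h4 : (Finset.Ico x ((b + 2) * s) \ B).card ≤ (Finset.Ico x ((b + 1) * s) \ B).card +
          (Finset.Ico ((b + 1) * s) ((b + 2) * s) \ B).card := by
        rw [hsplit]
        exact Finset.card_union_le _ _
      have h5 := Finset.card_sdiff_add_card_inter (Finset.Ico ((b + 1) * s) ((b + 2) * s)) B
      rw [hcard, ← hBb] at h5
      have h4' : ((Finset.Ico x ((b + 2) * s) \ B).card : ℝ) ≤
          (Finset.Ico x ((b + 1) * s) \ B).card +
          (Finset.Ico ((b + 1) * s) ((b + 2) * s) \ B).card := by exact_mod_cast h4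
      have h5' : ((Finset.Ico ((b + 1) * s) ((b + 2) * s) \ B).card : ℝ) +
        (B.filter fun z => z / s = b + 1).card = s := by exact_mod_cast h5
      have h6 : (0 : ℝ) ≤ (Finset.Ico x ((b + 2) * s) \ B).card := by positivity
      nlinarith
  rw [← Finset.sum_fiberwise_of_maps_to (t := T.image (· / s))
    fun x hx => Finset.mem_image_of_mem _ hx]
  refine (Finset.sum_le_sum hfib).trans ?_
  rw [← Finset.mul_sum]
  gcongr
  have hdisj : ((T.image (· / s) : Finset ℕ) : Set ℕ).PairwiseDisjoint
      fun b => B.filter fun z => z / s = b + 1 := by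
    intro b _ c _ hbc
    refine Finset.disjoint_filter.mpr fun z _ h1 h2 => hbc ?_
    omega
  have hsum := Finset.card_biUnion hdisj
  have hle : ∑ b ∈ T.image (· / s), (B.filter fun z => z / s = b + 1).card ≤ B.card := by
    rw [← hsum]
    exact Finset.card_le_card (Finset.biUnion_subset.mpr fun b _ => Finset.filter_subset _ _)
  exact_mod_cast hle

/-! ### Random centres -/

/-- The random choices: for each of the `τ` numberings, each scale `2 ^ j`, and each block of that
length, `t` elements of the block, given by their offsets. -/
abbrev Samples (τ K n t : ℕ) : Type :=
  ∀ i : Fin τ × Fin K × Fin n × Fin t, Fin (2 ^ (i.2.1 : ℕ))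

/-- Two positions are either adjacent or, on some scale, two or three blocks apart. -/
lemma exists_scale_separating {p q : ℕ} (hpq : p < q) : q = p + 1 ∨ ∃ j, 2 ^ j ≤ q ∧
    p / 2 ^ j + 2 ≤ q / 2 ^ j ∧ q / 2 ^ j ≤ p / 2 ^ j + 3 := by
  have hex : ∃ j, q / 2 ^ j ≤ p / 2 ^ j + 1 := ⟨q, by
    rw [Nat.div_eq_of_lt Nat.lt_two_pow_self]; exact Nat.zero_le _⟩
  classical
  have hJ := Nat.find_spec hex
  have hmin := fun j => Nat.find_min hex (m := j)
  cases hJ' : Nat.find hex with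
  | zero =>
    rw [hJ'] at hJ
    simp only [pow_zero, Nat.div_one] at hJ
    omega
  | succ j =>
    right
    have h1 := hmin j (by omega)
    rw [hJ', pow_succ, ← Nat.div_div_eq_div_mul, ← Nat.div_div_eq_div_mul] at hJ
    refine ⟨j, ?_, by omega, by omega⟩
    by_contra! hlt
    rw [Nat.div_eq_of_lt hlt] at h1
    exact h1 (Nat.zero_le _)

/-- In the numbering `a` and at scale `2 ^ j`, no fault-free element from position `p` on is among
the centres sampled from the block of `p` and the next one. -/
def Miss {τ K n t : ℕ} (B : Finset ℕ) (ω : Samples τ K n t) (a : Fin τ) (j : Fin K) (p : ℕ) :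
    Prop :=
  ∀ c : Fin n, ((c : ℕ) = p / 2 ^ (j : ℕ) ∨ (c : ℕ) = p / 2 ^ (j : ℕ) + 1) → ∀ l : Fin t,
    ¬ (p ≤ c * 2 ^ (j : ℕ) + ω (a, j, c, l) ∧ (c * 2 ^ (j : ℕ) + ω (a, j, c, l) : ℕ) ∉ B)

lemma card_filter_block (s c : ℕ) (P : ℕ → Prop) [DecidablePred P] :
    ((Finset.univ : Finset (Fin s)).filter fun u : Fin s => P (c * s + u)).card =
      ((Finset.Ico (c * s) ((c + 1) * s)).filter P).card := by
  refine Finset.card_bij (fun u _ => c * s + u) (fun u hu => ?_) (fun u _ v _ h => ?_)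
    fun z hz => ?_
  · have := u.2
    have h : (c + 1) * s = c * s + s := by ring
    simp only [Finset.mem_filter, Finset.mem_Ico, Finset.mem_univ, true_and] at hu ⊢
    exact ⟨by omega, hu⟩
  · exact Fin.ext (by simpa using h)
  · have h : (c + 1) * s = c * s + s := by ring
    simp only [Finset.mem_filter, Finset.mem_Ico, Finset.mem_univ, true_and] at hz ⊢
    have h2 : c * s + (z - c * s) = z := by omega
    exact ⟨⟨z - c * s, by omega⟩, by simpa only [h2] using hz.2, h2⟩

open Classical in
/-- The probability of a miss: the samples of the two blocks are independent. -/
lemma card_filter_miss {τ K n t : ℕ} (B : Finset ℕ) (a : Fin τ) (j : Fin K) (p : ℕ)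
    (hp : p / 2 ^ (j : ℕ) + 1 < n) :
    (((Finset.univ : Finset (Samples τ K n t)).filter fun ω => Miss B ω a j p).card : ℝ) =
      Fintype.card (Samples τ K n t) *
      ((1 - (Finset.Ico p ((p / 2 ^ (j : ℕ) + 1) * 2 ^ (j : ℕ)) \ B).card / (2 ^ (j : ℕ) : ℕ) : ℝ) *
        ((B.filter fun z => z / 2 ^ (j : ℕ) = p / 2 ^ (j : ℕ) + 1).card / (2 ^ (j : ℕ) : ℕ))) ^ t := by
  set s := 2 ^ (j : ℕ) with hs
  have hs0 : 0 < s := by positivity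
  have hs0' : (0 : ℝ) < s := by exact_mod_cast hs0
  set b := p / s with hb
  have hbp : b * s ≤ p := Nat.div_mul_le_self p s
  have hpb : p < (b + 1) * s := by
    rw [← Nat.div_lt_iff_lt_mul hs0]; omega
  let F : ∀ i : Fin τ × Fin K × Fin n × Fin t, Finset (Fin (2 ^ (i.2.1 : ℕ))) := fun i =>
    Finset.univ.filter fun u => i.1 = a → i.2.1 = j →
      ((i.2.2.1 : ℕ) = b ∨ (i.2.2.1 : ℕ) = b + 1) →
        ¬ (p ≤ i.2.2.1 * 2 ^ (i.2.1 : ℕ) + u ∧ (i.2.2.1 * 2 ^ (i.2.1 : ℕ) + u : ℕ) ∉ B)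
  have hF : ((Finset.univ : Finset (Samples τ K n t)).filter fun ω => Miss B ω a j p) =
      Fintype.piFinset F := by
    ext ω
    rw [Finset.mem_filter, Fintype.mem_piFinset]
    simp only [Finset.mem_filter, Finset.mem_univ, true_and, F, Miss]
    constructor
    · rintro h ⟨a', j', c, l⟩ rfl rfl hc
      exact h c hc l
    · intro h c hc l
      exact h (a, j, c, l) rfl rfl hc
  have hratio : (((Fintype.piFinset F).card : ℕ) : ℝ) / Fintype.card (Samples τ K n t) =
      ∏ i, ((F i).card / (2 ^ (i.2.1 : ℕ) : ℕ) : ℝ) := by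
    rw [Fintype.card_piFinset, Fintype.card_pi, Finset.prod_div_distrib]
    push_cast
    simp
  have hΩ : (0 : ℝ) < Fintype.card (Samples τ K n t) := by
    have : Nonempty (Samples τ K n t) := ⟨fun i => ⟨0, by positivity⟩⟩
    exact_mod_cast Fintype.card_pos
  rw [hF, (div_eq_iff hΩ.ne').mp hratio, mul_comm]
  congr 1
  have hone : ∀ i : Fin τ × Fin K × Fin n × Fin t,
      ¬ (i.1 = a ∧ i.2.1 = j ∧ ((i.2.2.1 : ℕ) = b ∨ (i.2.2.1 : ℕ) = b + 1)) →
      ((F i).card / (2 ^ (i.2.1 : ℕ) : ℕ) : ℝ) = 1 := by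
    intro i hi
    have : F i = Finset.univ := by
      ext u
      simp only [F, Finset.mem_filter, Finset.mem_univ, true_and, iff_true]
      intro h1 h2 h3
      exact absurd ⟨h1, h2, h3⟩ hi
    rw [this, Finset.card_univ, Fintype.card_fin, div_self (by positivity)]
  rw [Fintype.prod_prod_type, Fintype.prod_eq_single a, Fintype.prod_prod_type,
    Fintype.prod_eq_single j, Fintype.prod_prod_type,
    Fintype.prod_eq_mul (⟨b, by omega⟩ : Fin n) ⟨b + 1, hp⟩, mul_pow]
  · congr 1
    · rw [Finset.prod_congr rfl (g := fun _ => (1 - (Finset.Ico p ((b + 1) * s) \ B).card / s : ℝ)),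
        Finset.prod_const, Finset.card_univ, Fintype.card_fin]
      intro l _
      have h1 := Finset.card_filter_add_card_filter_not (s := (Finset.univ : Finset (Fin s)))
        (fun u => p ≤ b * s + u ∧ (b * s + u : ℕ) ∉ B)
      have h2 : (F (a, j, ⟨b, by omega⟩, l)) = Finset.univ.filter fun u : Fin s =>
          ¬ (p ≤ b * s + u ∧ (b * s + u : ℕ) ∉ B) := by
        ext u
        simp [F, hs]
      rw [card_filter_block s b (fun z => p ≤ z ∧ z ∉ B), ← h2] at h1
      have h3 : (Finset.Ico (b * s) ((b + 1) * s)).filter (fun z => p ≤ z ∧ z ∉ B) =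
          Finset.Ico p ((b + 1) * s) \ B := by
        ext z
        simp only [Finset.mem_filter, Finset.mem_Ico, Finset.mem_sdiff]
        constructor
        · rintro ⟨⟨-, h4⟩, h5, h6⟩
          exact ⟨⟨h5, h4⟩, h6⟩
        · rintro ⟨⟨h4, h5⟩, h6⟩
          exact ⟨⟨by omega, h5⟩, h4, h6⟩
      rw [h3, Finset.card_univ, Fintype.card_fin] at h1
      have h4 : ((Finset.Ico p ((b + 1) * s) \ B).card : ℝ) +
        (F (a, j, ⟨b, by omega⟩, l)).card = s := by exact_mod_cast h1
      change ((F (a, j, ⟨b, by omega⟩, l)).card / s : ℝ) = _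
      rw [eq_sub_iff_add_eq, ← add_div, add_comm, h4, div_self hs0'.ne']
    · rw [Finset.prod_congr rfl (g := fun _ => ((B.filter fun z => z / s = b + 1).card / s : ℝ)),
        Finset.prod_const, Finset.card_univ, Fintype.card_fin]
      intro l _
      have h2 : (F (a, j, ⟨b + 1, hp⟩, l)) = Finset.univ.filter fun u : Fin s =>
          (b + 1) * s + u ∈ B := by
        ext u
        have : p ≤ (b + 1) * 2 ^ (j : ℕ) + u := hpb.le.trans (Nat.le_add_right _ _)
        simp [F, hs, this]
      rw [h2, card_filter_block s (b + 1) (fun z => z ∈ B)]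
      congr 3
      ext z
      simp only [Finset.mem_filter, Finset.mem_Ico, ← Nat.div_lt_iff_lt_mul hs0,
        ← Nat.le_div_iff_mul_le hs0]
      constructor
      · rintro ⟨h4, h5⟩
        exact ⟨h5, by omega⟩
      · rintro ⟨h4, h5⟩
        exact ⟨by omega, h4⟩
  · intro h
    simpa using congrArg Fin.val h
  · rintro c ⟨hc1, hc2⟩
    refine Finset.prod_eq_one fun l _ => hone _ ?_
    rintro ⟨-, -, h | h⟩
    · exact hc1 (Fin.ext h)
    · exact hc2 (Fin.ext h)
  · intro j' hj'
    exact Finset.prod_eq_one fun _ _ => hone _ fun h => hj' h.2.1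
  · intro a' ha'
    exact Finset.prod_eq_one fun _ _ => hone _ fun h => ha' h.1

/-! ### The graph of hops -/

section Spanner

variable {X : Type*} {τ K n t : ℕ}

/-- A hop from `x` to `y`: in some numbering, `y` is the successor of `x`, or `y` is a sampled
element of a block of some scale, which lies at most three blocks before that of `x` and at most
one block after it. -/
def Hop (pos : Fin τ → X ≃ Fin n) (ω : Samples τ K n t) (x y : X) : Prop :=
  ∃ a, (pos a x : ℕ) + 1 = pos a y ∨ ∃ (j : Fin K) (c : Fin n) (l : Fin t),
    (c : ℕ) ≤ (pos a x : ℕ) / 2 ^ (j : ℕ) + 1 ∧ (pos a x : ℕ) / 2 ^ (j : ℕ) ≤ c + 3 ∧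
      (pos a y : ℕ) = c * 2 ^ (j : ℕ) + ω (a, j, c, l)

/-- The graph of all hops, each edge being weighted by the distance of its ends. -/
noncomputable def hopGraph [MetricSpace X] (pos : Fin τ → X ≃ Fin n) (ω : Samples τ K n t) :
    WeightedGraph X where
  graph := SimpleGraph.fromRel (Hop pos ω)
  weight := Sym2.lift ⟨nndist, nndist_comm⟩

lemma hopGraph_adj [MetricSpace X] {pos : Fin τ → X ≃ Fin n} {ω : Samples τ K n t} {x y : X}
    (h : Hop pos ω x y) : x = y ∨ (hopGraph pos ω).graph.Adj x y := by
  by_cases hxy : x = y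
  · exact Or.inl hxy
  · exact Or.inr ((SimpleGraph.fromRel_adj _ _ _).mpr ⟨hxy, Or.inl h⟩)

lemma hopGraph_dominates [MetricSpace X] (pos : Fin τ → X ≃ Fin n) (ω : Samples τ K n t) :
    (hopGraph pos ω).Dominates := by
  intro x y
  refine le_iInf fun p => ?_
  rw [edist_nndist, ENNReal.coe_le_coe]
  induction p with
  | nil => simp
  | @cons u v w h p ih =>
    refine (nndist_triangle u v w).trans ?_
    simp only [WeightedGraph.walkWeight, SimpleGraph.Walk.edges_cons, List.map_cons,
      List.sum_cons]
    exact add_le_add le_rfl ih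

lemma numEdges_hopGraph_le [MetricSpace X] [Fintype X] (hn : Fintype.card X = n) (hK : 1 ≤ K)
    (ht : 1 ≤ t) (pos : Fin τ → X ≃ Fin n) (ω : Samples τ K n t) :
    (hopGraph pos ω).numEdges ≤ 6 * (τ * n * (K * t)) := by
  classical
  -- Each hop out of `x` is determined by a numbering and an element of this index set.
  let I := Fin τ × X × Option (Fin K × Fin 5 × Fin t)
  let P : I → X → Prop := fun i y => match i.2.2 with
    | none => (pos i.1 i.2.1 : ℕ) + 1 = pos i.1 y
    | some w => ∃ c : Fin n, (c : ℕ) + w.2.1 = pos i.1 i.2.1 / 2 ^ (w.1 : ℕ) + 1 ∧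
        (pos i.1 y : ℕ) = c * 2 ^ (w.1 : ℕ) + ω (i.1, w.1, c, w.2.2)
  have hP : ∀ i y z, P i y → P i z → y = z := by
    rintro ⟨a, x, _ | ⟨j, o, l⟩⟩ y z hy hz
    · exact (pos a).injective (Fin.ext (hy.symm.trans hz))
    · obtain ⟨c, hc1, hc2⟩ := hy
      obtain ⟨d, hd1, hd2⟩ := hz
      obtain rfl : c = d := Fin.ext (by omega)
      exact (pos a).injective (Fin.ext (hc2.trans hd2.symm))
  have hHop : ∀ x y, Hop pos ω x y → ∃ i : I, i.2.1 = x ∧ P i y := by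
    rintro x y ⟨a, h | ⟨j, c, l, h1, h2, h3⟩⟩
    · exact ⟨(a, x, none), rfl, h⟩
    · exact ⟨(a, x, some (j, ⟨(pos a x : ℕ) / 2 ^ (j : ℕ) + 1 - c, by omega⟩, l)), rfl, c,
        Nat.add_sub_cancel' h1, h3⟩
  let f : I → Sym2 X := fun i => if h : ∃ y, P i y then s(i.2.1, h.choose) else s(i.2.1, i.2.1)
  have hf : ∀ x y, Hop pos ω x y → s(x, y) ∈ Set.range f := by
    intro x y h
    obtain ⟨i, rfl, hi⟩ := hHop x y h
    have hex : ∃ y, P i y := ⟨y, hi⟩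
    refine ⟨i, ?_⟩
    simp only [f, dif_pos hex]
    rw [hP i _ _ hex.choose_spec hi]
  have hsub : (hopGraph pos ω).graph.edgeSet ⊆ Set.range f := by
    intro e
    induction e using Sym2.ind with
    | _ x y =>
      intro h
      obtain ⟨-, h | h⟩ := (SimpleGraph.fromRel_adj _ _ _).mp ((SimpleGraph.mem_edgeSet _).mp h)
      · exact hf x y h
      · rw [Sym2.eq_swap]; exact hf y x h
  calc (hopGraph pos ω).numEdges ≤ (Set.range f).ncard := Set.ncard_le_ncard hsub
    _ ≤ Fintype.card I := by
      rw [← Set.image_univ]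
      exact (Set.ncard_image_le).trans (by rw [Set.ncard_univ, Nat.card_eq_fintype_card])
    _ = τ * n * (K * t * 5 + 1) := by
      simp only [I, Fintype.card_prod, Fintype.card_option, Fintype.card_fin, hn]
      ring
    _ ≤ τ * n * (K * t * 5 + K * t) := by
      gcongr
      exact Nat.mul_pos hK ht
    _ = _ := by ring

/-- Position `p` of the numbering `a` lies in the shadow of the faults, or it is fault-free and
misses all usable centres on some scale. Otherwise it reaches every fault-free point on its right. -/
def Fails (B : Finset ℕ) (δ : ℝ) (ω : Samples τ K n t) (a : Fin τ) (p : ℕ) : Prop :=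
  p ∈ shadow B δ ∨ p ∉ B ∧ p ∉ shadow B δ ∧
    ∃ j : Fin K, p / 2 ^ (j : ℕ) + 1 < n ∧ Miss B ω a j p

open Classical in
/-- The positions in the numbering `a` of the elements of `B`. -/
noncomputable def positions (pos : Fin τ → X ≃ Fin n) (a : Fin τ) (B : Finset X) : Finset ℕ :=
  B.image fun x => (pos a x : ℕ)

lemma mem_positions {pos : Fin τ → X ≃ Fin n} {a : Fin τ} {B : Finset X} {x : X} :
    (pos a x : ℕ) ∈ positions pos a B ↔ x ∈ B := by
  classical
  simp only [positions, Finset.mem_image]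
  constructor
  · rintro ⟨y, hy, h⟩
    rwa [← (pos a).injective (Fin.ext h)]
  · exact fun h => ⟨x, h, rfl⟩

lemma card_positions_le (pos : Fin τ → X ≃ Fin n) (a : Fin τ) (B : Finset X) :
    (positions pos a B).card ≤ B.card := by
  classical
  exact Finset.card_image_le

/-- Two fault-free points, the left one of which does not fail, are joined by at most two hops by
way of a fault-free point between them. -/
lemma exists_common_hop {pos : Fin τ → X ≃ Fin n} {ω : Samples τ K n t} (hK : n ≤ 2 ^ K)
    {B : Finset X} {δ : ℝ} {a : Fin τ} {x y : X} (hxB : x ∉ B) (hyB : y ∉ B)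
    (hx : ¬ Fails (positions pos a B) δ ω a (pos a x)) (hxy : pos a x < pos a y) :
    ∃ z, z ∉ B ∧ pos a x ≤ pos a z ∧ pos a z ≤ pos a y ∧
      (x = z ∨ Hop pos ω x z) ∧ (y = z ∨ Hop pos ω y z) := by
  rcases exists_scale_separating hxy with h | ⟨j, hj, hj2, hj3⟩
  · exact ⟨y, hyB, hxy.le, le_rfl, Or.inr ⟨a, Or.inl h.symm⟩, Or.inl rfl⟩
  have hjK : j < K := (Nat.pow_lt_pow_iff_right (by norm_num)).mp
    ((hj.trans_lt (pos a y).2).trans_le hK)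
  have hs : 0 < 2 ^ j := by positivity
  have hyn := (pos a y).2
  have hdiv : (pos a y : ℕ) / 2 ^ j ≤ pos a y := Nat.div_le_self _ _
  have hmiss : ¬ Miss (positions pos a B) ω a ⟨j, hjK⟩ (pos a x) := by
    intro hm
    refine hx ?_
    by_cases hsh : (pos a x : ℕ) ∈ shadow (positions pos a B) δ
    · exact Or.inl hsh
    · exact Or.inr ⟨fun h => hxB (mem_positions.mp h), hsh, ⟨j, hjK⟩, by dsimp only; omega, hm⟩
  simp only [Miss, not_forall, not_not] at hmiss
  obtain ⟨c, hc, l, hxz, hzB⟩ := hmiss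
  have hu := (ω (a, ⟨j, hjK⟩, c, l)).2
  set z : ℕ := c * 2 ^ j + ω (a, ⟨j, hjK⟩, c, l) with hz
  have hzy : z < pos a y := by
    have h1 : ((c : ℕ) + 1) * 2 ^ j ≤ pos a y :=
      (Nat.le_div_iff_mul_le hs).mp (by omega)
    rw [add_mul, one_mul] at h1
    exact (Nat.add_lt_add_left hu _).trans_le h1
  obtain ⟨w, hw⟩ : ∃ w, (pos a w : ℕ) = z :=
    ⟨(pos a).symm ⟨z, by omega⟩, by rw [Equiv.apply_symm_apply]⟩
  refine ⟨w, fun h => hzB (hw ▸ mem_positions.mpr h), ?_, ?_, Or.inr ⟨a, Or.inr ⟨⟨j, hjK⟩, c, l,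
    ?_, ?_, hw⟩⟩, Or.inr ⟨a, Or.inr ⟨⟨j, hjK⟩, c, l, ?_, ?_, hw⟩⟩⟩
  · exact Fin.le_def.mpr (hw ▸ hxz)
  · exact Fin.le_def.mpr (hw ▸ hzy.le)
  all_goals dsimp only at hc ⊢; omega

open Classical in
/-- The expected number of fault-free points failing in some numbering. -/
lemma sum_card_fails_le [Fintype X] {δ : ℝ} (hK : 1 ≤ K) (hδ : 0 < δ) (hδ1 : δ ≤ 1)
    (ht : 4 / δ * (1 + Real.log K) ≤ t) (pos : Fin τ → X ≃ Fin n) (B : Finset X) :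
    ∑ ω : Samples τ K n t, ((Finset.univ.filter fun x : X =>
        ∃ a, Fails (positions pos a B) δ ω a (pos a x)).card : ℝ) ≤
      Fintype.card (Samples τ K n t) * (2 * τ * δ * B.card) := by
  let S : Fin τ → Finset ℕ := fun a =>
    (Finset.range n).filter (· ∈ shadow (positions pos a B) δ)
  let T : Fin τ → Fin K → Finset ℕ := fun a j => (Finset.range n).filter fun p =>
    p ∉ positions pos a B ∧ p ∉ shadow (positions pos a B) δ ∧ p / 2 ^ (j : ℕ) + 1 < n
  have hK0 : (1 : ℝ) ≤ K := by exact_mod_cast hK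
  have hcard : ∀ a, ((positions pos a B).card : ℝ) ≤ B.card := fun a => by
    exact_mod_cast card_positions_le pos a B
  have hpoint : ∀ ω : Samples τ K n t, ((Finset.univ.filter fun x : X =>
      ∃ a, Fails (positions pos a B) δ ω a (pos a x)).card : ℝ) ≤
      ∑ a, (((S a).card : ℝ) +
        ∑ j, ∑ p ∈ T a j, if Miss (positions pos a B) ω a j p then 1 else 0) := by
    intro ω
    have h1 : (Finset.univ.filter fun x : X =>
        ∃ a, Fails (positions pos a B) δ ω a (pos a x)) ⊆
        Finset.univ.biUnion fun a => Finset.univ.filter fun x : X =>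
          (pos a x : ℕ) ∈ S a ∪ Finset.univ.biUnion fun j => (T a j).filter fun p =>
            Miss (positions pos a B) ω a j p := by
      intro x hx
      obtain ⟨a, ha⟩ := (Finset.mem_filter.mp hx).2
      refine Finset.mem_biUnion.mpr ⟨a, Finset.mem_univ _,
        Finset.mem_filter.mpr ⟨Finset.mem_univ _, ?_⟩⟩
      rcases ha with ha | ⟨h1, h2, j, h3, h4⟩
      · exact Finset.mem_union_left _ (Finset.mem_filter.mpr
          ⟨Finset.mem_range.mpr (pos a x).2, ha⟩)
      · exact Finset.mem_union_right _ (Finset.mem_biUnion.mpr ⟨j, Finset.mem_univ _,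
          Finset.mem_filter.mpr ⟨Finset.mem_filter.mpr
            ⟨Finset.mem_range.mpr (pos a x).2, h1, h2, h3⟩, h4⟩⟩)
    have h2 : (Finset.univ.filter fun x : X =>
        ∃ a, Fails (positions pos a B) δ ω a (pos a x)).card ≤
        ∑ a, ((S a).card + ∑ j, ((T a j).filter fun p =>
          Miss (positions pos a B) ω a j p).card) := by
      refine (Finset.card_le_card h1).trans (Finset.card_biUnion_le.trans ?_)
      refine Finset.sum_le_sum fun a _ => ?_
      refine (Finset.card_le_card_of_injOn (t := S a ∪ Finset.univ.biUnion fun j =>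
          (T a j).filter fun p => Miss (positions pos a B) ω a j p)
        (fun x => (pos a x : ℕ)) (fun x hx => (Finset.mem_filter.mp hx).2)
        (Fin.val_injective.comp (pos a).injective).injOn).trans ?_
      refine (Finset.card_union_le _ _).trans ?_
      gcongr
      exact Finset.card_biUnion_le
    refine (Nat.cast_le.mpr h2).trans (le_of_eq ?_)
    push_cast
    simp only [Finset.card_filter, Nat.cast_sum, Nat.cast_ite, Nat.cast_one, Nat.cast_zero]
  have hS : ∀ a, ((S a).card : ℝ) ≤ δ * B.card := fun a =>
    (card_le_of_subset_shadow hδ.le fun x hx => (Finset.mem_filter.mp hx).2).trans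
      (mul_le_mul_of_nonneg_left (hcard a) hδ.le)
  have hT : ∀ a j, ∑ ω : Samples τ K n t, ∑ p ∈ T a j,
      (if Miss (positions pos a B) ω a j p then (1 : ℝ) else 0) ≤
      Fintype.card (Samples τ K n t) * (δ / K * B.card) := by
    intro a j
    rw [Finset.sum_comm]
    simp only [Finset.sum_boole]
    rw [Finset.sum_congr rfl fun p hp =>
      card_filter_miss _ a j p (Finset.mem_filter.mp hp).2.2.2, ← Finset.mul_sum]
    gcongr
    refine (sum_miss_probability_le_card (by positivity) hδ hδ1 hK0 ht _ _ fun p hp => ?_).trans ?_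
    · exact ⟨(Finset.mem_filter.mp hp).2.1, (Finset.mem_filter.mp hp).2.2.1⟩
    · exact mul_le_mul_of_nonneg_left (hcard a) (by positivity)
  calc _ ≤ ∑ ω : Samples τ K n t, ∑ a, (((S a).card : ℝ) +
        ∑ j, ∑ p ∈ T a j, if Miss (positions pos a B) ω a j p then 1 else 0) :=
        Finset.sum_le_sum fun ω _ => hpoint ω
    _ = ∑ a, (Fintype.card (Samples τ K n t) * ((S a).card : ℝ) +
        ∑ j, ∑ ω : Samples τ K n t, ∑ p ∈ T a j,
          if Miss (positions pos a B) ω a j p then 1 else 0) := by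
        rw [Finset.sum_comm]
        refine Finset.sum_congr rfl fun a _ => ?_
        rw [Finset.sum_add_distrib, Finset.sum_const, Finset.card_univ, nsmul_eq_mul,
          Finset.sum_comm]
    _ ≤ ∑ _a : Fin τ, (Fintype.card (Samples τ K n t) * (δ * B.card) +
        ∑ _j : Fin K, Fintype.card (Samples τ K n t) * (δ / K * B.card)) := by
        gcongr with a _ j _
        · exact hS a
        · exact hT a j
    _ = _ := by
        simp only [Finset.sum_const, Finset.card_univ, Fintype.card_fin, nsmul_eq_mul]
        field_simp
        ring

end Spanner

/-! ### Path distances and image distributions -/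

namespace WeightedGraph

lemma pathDist_triangle {X : Type*} (H : WeightedGraph X) (x z y : X) :
    H.pathDist x y ≤ H.pathDist x z + H.pathDist z y := by
  unfold pathDist
  simp only [ENNReal.iInf_add, ENNReal.add_iInf]
  refine le_iInf fun q => le_iInf fun p => (iInf_le _ (p.append q)).trans ?_
  simp [walkWeight, SimpleGraph.Walk.edges_append]

end WeightedGraph

lemma PMF.tsum_map_mul {α β : Type*} (p : PMF α) (f : α → β) (g : β → ℝ≥0∞) :
    ∑' b, p.map f b * g b = ∑' a, p a * g (f a) := by
  classical
  simp only [PMF.map_apply, ← ENNReal.tsum_mul_right]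
  rw [ENNReal.tsum_comm]
  refine tsum_congr fun a => ?_
  rw [tsum_eq_single (f a) fun b hb => by rw [if_neg hb, zero_mul], if_pos rfl]

/-! ### Estimates of the number of edges -/

/-- The spanner has of order `τ ^ 2 * n * ν⁻¹ * log n * max 1 (log log n)` edges: each of the `τ`
numberings needs samples of a size proportional to `τ / ν`. The factor `τ ^ 2` accounts for
`n ^ (1 / k)`. -/
lemma edge_bound {n k K t τ : ℕ} {C₁ ν ε Q : ℝ} (hn : 2 ≤ n) (hk : 1 ≤ k) (hν : 0 < ν) (hν1 : ν < 1)
    (hε : 0 < ε) (hC₁ : 0 < C₁) (hτ : 0 < τ) (hK : K = Nat.clog 2 n)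
    (ht : t = ⌈4 / (ν / (2 * τ)) * (1 + Real.log K)⌉₊) (hQ : Q = (n : ℝ) ^ (1 / (2 * k) : ℝ))
    (hkε : 1 < k / ε)
    (hτ' : (τ : ℝ) ≤ C₁ * (k / ε * Real.log (k / ε)) * Q * Real.log n) :
    ((6 * (τ * n * (K * t)) : ℕ) : ℝ) ≤ (n : ℝ) ^ (1 + 1 / (k : ℝ)) * ν⁻¹ * Real.log n ^ 3 *
      max 1 (Real.log (Real.log n)) * ((k : ℝ) ^ 4 / ε ^ 2) *
        (27 * C₁ * Real.log (k / ε)) ^ 2 := by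
  have hn' : (2 : ℝ) ≤ n := by exact_mod_cast hn
  have hk' : (1 : ℝ) ≤ k := by exact_mod_cast hk
  have hτ1 : (1 : ℝ) ≤ τ := by exact_mod_cast hτ
  have hl2 := Real.log_two_gt_d9
  have hL2 := Real.log_le_log (by norm_num) hn'
  have hL0 : 0 < Real.log n := by linarith
  have hA := Real.log_pos hkε
  set L := Real.log n with hL
  set A := Real.log (k / ε) with hA'
  set M := max 1 (Real.log L) with hM
  have hM1 : 1 ≤ M := le_max_left _ _
  have hM2 : Real.log L ≤ M := le_max_right _ _
  have hK1 : 1 ≤ K := hK ▸ Nat.clog_pos (by norm_num) hn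
  have hK1' : (1 : ℝ) ≤ K := by exact_mod_cast hK1
  have hKL : (K : ℝ) ≤ 3 * L := by
    have h1 : 2 ^ (K - 1) < n := hK ▸ Nat.pow_pred_clog_lt_self (by norm_num) hn
    have h2 : ((2 : ℝ) ^ (K - 1)) ≤ n := by exact_mod_cast h1.le
    have h3 := Real.log_le_log (by positivity) h2
    rw [Real.log_pow, Nat.cast_sub hK1, Nat.cast_one] at h3
    nlinarith
  have hlK : 1 + Real.log K ≤ 4 * M := by
    have h1 := Real.log_le_log (by linarith) hKL
    rw [Real.log_mul (by norm_num) hL0.ne'] at h1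
    have h2 := Real.log_le_sub_one_of_pos (show (0 : ℝ) < 3 by norm_num)
    linarith
  have hlK0 : 0 ≤ Real.log K := Real.log_nonneg hK1'
  have htb : (t : ℝ) ≤ 40 * (τ / ν) * M := by
    have hτν : 1 ≤ τ / ν := by rw [le_div_iff₀ hν]; linarith
    have h1 := Nat.ceil_lt_add_one (a := 4 / (ν / (2 * τ)) * (1 + Real.log K)) (by positivity)
    rw [← ht] at h1
    have h2 : 4 / (ν / (2 * τ)) = 8 * (τ / ν) := by field_simp; norm_num
    rw [h2] at h1
    have h3 : 8 * (τ / ν) * (1 + Real.log K) ≤ 8 * (τ / ν) * (4 * M) := by gcongr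
    have h4 : 1 * 1 ≤ (τ / ν) * M := by gcongr
    linarith
  have hQ2 : Q ^ 2 * n = (n : ℝ) ^ (1 + 1 / (k : ℝ)) := by
    rw [hQ, ← Real.rpow_natCast, ← Real.rpow_mul (by linarith), Real.rpow_add (by linarith),
      Real.rpow_one, mul_comm]
    congr 2
    push_cast
    field_simp
  have hQ0 : 0 < Q := hQ ▸ Real.rpow_pos_of_pos (by linarith) _
  calc ((6 * (τ * n * (K * t)) : ℕ) : ℝ) = 6 * (τ * n * (K * t)) := by push_cast; ring
    _ ≤ 6 * (τ * n * (3 * L * (40 * (τ / ν) * M))) := by gcongr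
    _ = 720 * (n * ν⁻¹ * L * M) * (τ : ℝ) ^ 2 := by field_simp; ring
    _ ≤ 720 * (n * ν⁻¹ * L * M) * (C₁ * (k / ε * A) * Q * L) ^ 2 := by gcongr
    _ = (Q ^ 2 * n) * ν⁻¹ * L ^ 3 * M * ((k : ℝ) ^ 2 / ε ^ 2) * (720 * (C₁ * A) ^ 2) := by
      field_simp
    _ ≤ (Q ^ 2 * n) * ν⁻¹ * L ^ 3 * M * ((k : ℝ) ^ 4 / ε ^ 2) * (729 * (C₁ * A) ^ 2) := by
      gcongr <;> norm_num
    _ = _ := by rw [hQ2]; ring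

/-- The doubly logarithmic factor and the square of `log (k / ε)` together are bounded by the cube
of the logarithm of `f = log n ^ 3 * k ^ 4 / ε ^ 2`. The case `n = 2` is the critical one: there
`log (log n)` is negative. -/
lemma max_mul_log_sq_le {n k : ℕ} {ε : ℝ} (hn : 2 ≤ n) (hk : 1 ≤ k) (hε : 0 < ε) (hε2 : ε < 1 / 2) :
    max 1 (Real.log (Real.log n)) * Real.log (k / ε) ^ 2 ≤
      23125 * Real.log (Real.log n ^ 3 * ((k : ℝ) ^ 4 / ε ^ 2)) ^ 3 := by
  have hn' : (2 : ℝ) ≤ n := by exact_mod_cast hn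
  have hk' : (1 : ℝ) ≤ k := by exact_mod_cast hk
  have hl2 := Real.log_two_gt_d9
  have hL2 := Real.log_le_log (by norm_num) hn'
  have hL0 : 0 < Real.log n := by linarith
  have hkε : 2 ≤ (k : ℝ) / ε := by rw [le_div_iff₀ hε]; linarith
  have hA := Real.log_le_log (by norm_num) hkε
  have hll : -0.4428 ≤ Real.log (Real.log n) := by
    have h1 := Real.one_sub_inv_le_log_of_pos hL0
    have h2 : (Real.log n)⁻¹ ≤ (0.6931)⁻¹ := inv_anti₀ (by norm_num) (by linarith)
    norm_num at h1 h2 ⊢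
    linarith
  have hk4 : ((k : ℝ) / ε) ^ 2 ≤ (k : ℝ) ^ 4 / ε ^ 2 := by
    rw [div_pow]
    gcongr
    norm_num
  have hlog : 3 * Real.log (Real.log n) + 2 * Real.log (k / ε) ≤
      Real.log (Real.log n ^ 3 * ((k : ℝ) ^ 4 / ε ^ 2)) := by
    rw [Real.log_mul (by positivity) (by positivity), Real.log_pow]
    have := Real.log_le_log (by positivity) hk4
    rw [Real.log_pow] at this
    push_cast at this ⊢
    linarith
  set F := Real.log (Real.log n ^ 3 * ((k : ℝ) ^ 4 / ε ^ 2))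
  have h1 : Real.log (k / ε) ≤ 25 * F := by linarith
  have h2 : max 1 (Real.log (Real.log n)) ≤ 37 * F := max_le (by linarith) (by linarith)
  calc max 1 (Real.log (Real.log n)) * Real.log (k / ε) ^ 2 ≤ 37 * F * (25 * F) ^ 2 := by
        gcongr <;> linarith
    _ = _ := by ring

/-! ### Reliability -/

lemma hopGraph_induce_pathDist_le {X : Type*} {τ K n t : ℕ} [MetricSpace X]
    (pos : Fin τ → X ≃ Fin n) (ω : Samples τ K n t) (S : Set X) (x y : S)
    (h : (x : X) = y ∨ (hopGraph pos ω).graph.Adj x y) :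
    ((hopGraph pos ω).induce S).pathDist x y ≤ edist (x : X) y := by
  rcases h with h | h
  · obtain rfl := Subtype.ext h
    refine (iInf_le _ SimpleGraph.Walk.nil).trans ?_
    simp [WeightedGraph.walkWeight]
  · have h' : ((hopGraph pos ω).induce S).graph.Adj x y := h
    refine (iInf_le _ (SimpleGraph.Walk.cons h' SimpleGraph.Walk.nil)).trans (le_of_eq ?_)
    rw [edist_nndist]
    simp only [WeightedGraph.walkWeight, SimpleGraph.Walk.edges_cons, SimpleGraph.Walk.edges_nil,
      List.map_cons, List.map_nil, List.sum_cons, List.sum_nil, add_zero]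
    rfl

/-- Outside the faults and the failing points, the spanner survives the attack. -/
lemma hopGraph_reliable {X : Type*} {τ K n t : ℕ} [MetricSpace X] {pos : Fin τ → X ≃ Fin n}
    (hK : n ≤ 2 ^ K) {r : ℝ} (hpos : ∀ x y, x ≠ y → ∃ a, ∀ z,
      pos a z ∈ Set.uIcc (pos a x) (pos a y) → dist x z + dist z y ≤ r * dist x y)
    (ω : Samples τ K n t) (B : Finset X) {δ : ℝ} (x y : ((B : Set X)ᶜ : Set X))
    (hx : ∀ a, ¬ Fails (positions pos a B) δ ω a (pos a x))
    (hy : ∀ a, ¬ Fails (positions pos a B) δ ω a (pos a y)) :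
    ((hopGraph pos ω).induce (B : Set X)ᶜ).pathDist x y ≤
      ENNReal.ofReal r * edist (x : X) (y : X) := by
  by_cases hxy : (x : X) = y
  · refine (hopGraph_induce_pathDist_le pos ω _ x y (Or.inl hxy)).trans ?_
    rw [hxy, edist_self]
    exact bot_le
  have hxB : (x : X) ∉ B := fun h => x.2 (Finset.mem_coe.mpr h)
  have hyB : (y : X) ∉ B := fun h => y.2 (Finset.mem_coe.mpr h)
  obtain ⟨a, ha⟩ := hpos x y hxy
  obtain ⟨z, hzB, hz, hxz, hyz⟩ : ∃ z, z ∉ B ∧ pos a z ∈ Set.uIcc (pos a x) (pos a y) ∧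
      ((x : X) = z ∨ Hop pos ω x z) ∧ ((y : X) = z ∨ Hop pos ω y z) := by
    rcases lt_or_gt_of_ne fun h => hxy ((pos a).injective h) with h | h
    · obtain ⟨z, h1, h2, h3, h4, h5⟩ := exists_common_hop hK hxB hyB (hx a) h
      exact ⟨z, h1, Set.mem_uIcc.mpr (Or.inl ⟨h2, h3⟩), h4, h5⟩
    · obtain ⟨z, h1, h2, h3, h4, h5⟩ := exists_common_hop hK hyB hxB (hy a) h
      exact ⟨z, h1, Set.mem_uIcc.mpr (Or.inr ⟨h2, h3⟩), h5, h4⟩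
  have hadj : ∀ w : X, w = z ∨ Hop pos ω w z → w = z ∨ (hopGraph pos ω).graph.Adj w z :=
    fun w h => h.elim Or.inl hopGraph_adj
  let z' : ((B : Set X)ᶜ : Set X) := ⟨z, fun h => hzB (Finset.mem_coe.mp h)⟩
  have h1 := hopGraph_induce_pathDist_le pos ω (B : Set X)ᶜ x z' (hadj x hxz)
  have h2 := hopGraph_induce_pathDist_le pos ω (B : Set X)ᶜ z' y
    ((hadj y hyz).imp Eq.symm SimpleGraph.Adj.symm)
  refine (WeightedGraph.pathDist_triangle _ x z' y).trans ((add_le_add h1 h2).trans ?_)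
  rw [edist_dist, edist_dist, edist_dist, ← ENNReal.ofReal_add dist_nonneg dist_nonneg,
    ← ENNReal.ofReal_mul' dist_nonneg]
  exact ENNReal.ofReal_le_ofReal (ha z hz)

/-- The numberings turn into a spanner, by sampling with a failure rate of `ν / (2 * τ)` for
each. -/
lemma exists_spanner_of_orderings {X : Type*} {τ K n t : ℕ} [MetricSpace X] [Fintype X] {r ν : ℝ}
    (hn : Fintype.card X = n) (hK : n ≤ 2 ^ K) (hK1 : 1 ≤ K) (hτ : 0 < τ) (hν : 0 < ν) (hν1 : ν < 1)
    (ht : 4 / (ν / (2 * τ)) * (1 + Real.log K) ≤ t) (ht1 : 1 ≤ t)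
    (pos : Fin τ → X ≃ Fin n) (hpos : ∀ x y, x ≠ y → ∃ a, ∀ z,
      pos a z ∈ Set.uIcc (pos a x) (pos a y) → dist x z + dist z y ≤ r * dist x y) :
    ∃ D : PMF (WeightedGraph X), IsObliviousReliableSpanner D ν r ∧
      HasAtMostEdges D ((6 * (τ * n * (K * t)) : ℕ) : ℝ) := by
  classical
  have hτ' : (1 : ℝ) ≤ τ := by exact_mod_cast hτ
  have : Nonempty (Samples τ K n t) := ⟨fun i => ⟨0, by positivity⟩⟩
  let D : PMF (WeightedGraph X) := (PMF.uniformOfFintype (Samples τ K n t)).map (hopGraph pos)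
  have hD : ∀ H ∈ D.support, ∃ ω, hopGraph pos ω = H := fun H hH => by
    obtain ⟨ω, -, h⟩ := (PMF.mem_support_map_iff _ _ _).mp hH
    exact ⟨ω, h⟩
  refine ⟨D, ⟨fun H hH => ?_, fun B => ?_⟩, fun H hH => ?_⟩
  · obtain ⟨ω, rfl⟩ := hD H hH
    exact hopGraph_dominates pos ω
  · set δ := ν / (2 * τ) with hδ
    have hδ0 : 0 < δ := by positivity
    have hδ1 : δ ≤ 1 := by rw [hδ, div_le_one (by positivity)]; linarith
    let P : WeightedGraph X → Finset X → Prop := fun H S => B ⊆ S ∧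
      ∀ x y : ((B : Set X)ᶜ : Set X), (x : X) ∉ S → (y : X) ∉ S →
        (H.induce (B : Set X)ᶜ).pathDist x y ≤ ENNReal.ofReal r * edist (x : X) (y : X)
    let E : Samples τ K n t → Finset X := fun ω => B ∪ Finset.univ.filter fun x : X =>
      ∃ a, Fails (positions pos a B) δ ω a (pos a x)
    have hE : ∀ ω, P (hopGraph pos ω) (E ω) := fun ω => by
      refine ⟨Finset.subset_union_left, fun x y hx hy => ?_⟩
      simp only [E, Finset.mem_union, Finset.mem_filter, Finset.mem_univ, true_and, not_or,
        not_exists] at hx hy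
      exact hopGraph_reliable hK hpos ω B x y hx.2 hy.2
    -- Several samples may give the same graph; the smallest valid extension serves all of them.
    have hmin : ∀ H, ∃ S, ∀ S', P H S' → P H S ∧ S.card ≤ S'.card := fun H => by
      by_cases h : ∃ S, P H S
      · obtain ⟨S, hS, hS'⟩ := Set.exists_min_image {S | P H S} Finset.card (Set.toFinite _) h
        exact ⟨S, fun S' h' => ⟨hS, hS' S' h'⟩⟩
      · exact ⟨∅, fun S' h' => absurd ⟨S', h'⟩ h⟩
    choose Bp hBp using hmin
    refine ⟨Bp, fun H hH => ?_, ?_⟩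
    · obtain ⟨ω, rfl⟩ := hD H hH
      exact (hBp _ _ (hE ω)).1
    · rw [PMF.tsum_map_mul, tsum_fintype]
      simp only [PMF.uniformOfFintype_apply]
      rw [← Finset.mul_sum]
      have hΩ : 0 < Fintype.card (Samples τ K n t) := Fintype.card_pos
      rw [mul_comm, ← div_eq_mul_inv]
      refine ENNReal.div_le_of_le_mul ?_
      have hsum : ∑ ω : Samples τ K n t, ((Bp (hopGraph pos ω)).card : ℝ) ≤
          (1 + ν) * B.card * Fintype.card (Samples τ K n t) := by
        calc ∑ ω : Samples τ K n t, ((Bp (hopGraph pos ω)).card : ℝ)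
            ≤ ∑ ω : Samples τ K n t, (B.card + (Finset.univ.filter fun x : X =>
                ∃ a, Fails (positions pos a B) δ ω a (pos a x)).card : ℝ) := by
              refine Finset.sum_le_sum fun ω _ => ?_
              exact_mod_cast ((hBp _ _ (hE ω)).2).trans (Finset.card_union_le _ _)
          _ ≤ Fintype.card (Samples τ K n t) * B.card +
              Fintype.card (Samples τ K n t) * (2 * τ * δ * B.card) := by
              rw [Finset.sum_add_distrib, Finset.sum_const, Finset.card_univ, nsmul_eq_mul]
              gcongr
              exact sum_card_fails_le hK1 hδ0 hδ1 ht pos B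
          _ = _ := by rw [hδ]; field_simp
      have h2 := ENNReal.ofReal_le_ofReal hsum
      rw [ENNReal.ofReal_sum_of_nonneg fun _ _ => Nat.cast_nonneg _,
        ENNReal.ofReal_mul (by positivity), ENNReal.ofReal_mul (by positivity)] at h2
      simpa only [ENNReal.ofReal_natCast] using h2
  · obtain ⟨ω, rfl⟩ := hD H hH
    exact_mod_cast numEdges_hopGraph_le hn hK1 ht1 pos ω

/-- A space with at most one point is its own spanner, without edges. -/
lemma exists_spanner_of_subsingleton (X : Type*) [MetricSpace X] [Fintype X] [Subsingleton X]
    {ν r : ℝ} (hν : 0 ≤ ν) : ∃ D : PMF (WeightedGraph X), IsObliviousReliableSpanner D ν r ∧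
      ∀ m : ℝ, 0 ≤ m → HasAtMostEdges D m := by
  let H : WeightedGraph X := ⟨⊥, fun _ => 0⟩
  refine ⟨PMF.pure H, ⟨fun _ _ x y => ?_, fun B => ⟨fun _ => B, fun G _ => ⟨subset_rfl, ?_⟩, ?_⟩⟩,
    fun m hm G hG => ?_⟩
  · rw [Subsingleton.elim x y, edist_self]
    exact bot_le
  · intro x y _ _
    obtain rfl : x = y := Subsingleton.elim _ _
    refine (iInf_le _ SimpleGraph.Walk.nil).trans ?_
    simp [WeightedGraph.walkWeight]
  · rw [ENNReal.tsum_mul_right, PMF.tsum_coe]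
    gcongr
    rw [ENNReal.one_le_ofReal]
    linarith
  · have : G.graph.edgeSet = ∅ := by
      rw [Subsingleton.elim G.graph ⊥, SimpleGraph.edgeSet_bot]
    rw [WeightedGraph.numEdges, this, Set.ncard_empty, Nat.cast_zero]
    exact hm

theorem mainTheorem3 :
    ∃ (C : ℝ) (c : ℕ), 0 < C ∧
      ∀ (X : Type*) [MetricSpace X] [Fintype X] (n : ℕ), Fintype.card X = n →
      ∀ (ν ε : ℝ) (k : ℕ), 0 < ν → ν < 1 → 0 < ε → ε < 1 / 2 → 1 ≤ k →
        ∃ D : PMF (WeightedGraph X),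
          IsObliviousReliableSpanner D ν (8 * (k : ℝ) + ε) ∧
          HasAtMostEdges D
            ((n : ℝ) ^ (1 + 1 / (k : ℝ)) * ν⁻¹ * Real.log n ^ 3 *
              max 1 (Real.log (Real.log n)) *
              ((k : ℝ) ^ 4 / ε ^ 2) * (C * Real.log ((k : ℝ) / ε)) ^ 2) ∧
          HasAtMostEdges D
            ((n : ℝ) ^ (1 + 1 / (k : ℝ)) * ν⁻¹ *
              (C * (Real.log n ^ 3 * ((k : ℝ) ^ 4 / ε ^ 2)) *
                Real.log (Real.log n ^ 3 * ((k : ℝ) ^ 4 / ε ^ 2)) ^ c)) := by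
  obtain ⟨C₁, hC₁, hord⟩ := exists_orderings
  set C₀ := 27 * C₁ with hC₀
  have hC₀0 : 0 < C₀ := by positivity
  refine ⟨C₀ + 23125 * C₀ ^ 2, 3, by positivity, fun X _ _ n hn ν ε k hν hν1 hε hε2 hk => ?_⟩
  rcases Nat.lt_or_ge n 2 with hn2 | hn2
  · have : Subsingleton X := Fintype.card_le_one_iff_subsingleton.mp (by omega)
    have hlog : Real.log n = 0 := by
      interval_cases n <;> simp
    obtain ⟨D, hD, hm⟩ := exists_spanner_of_subsingleton X (r := 8 * (k : ℝ) + ε) hν.le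
    refine ⟨D, hD, hm _ ?_, hm _ ?_⟩ <;> simp [hlog]
  have hkε : 1 < (k : ℝ) / ε := by
    have hk' : (1 : ℝ) ≤ k := by exact_mod_cast hk
    rw [lt_div_iff₀ hε]; linarith
  obtain ⟨τ, pos, hτ, hpos⟩ := hord X n hn hn2 ε k hε hε2 hk
  have hτ0 : 0 < τ := by
    obtain ⟨x, y, hxy⟩ := Fintype.one_lt_card_iff.mp (by omega : 1 < Fintype.card X)
    exact (hpos x y hxy).choose.pos
  set K := Nat.clog 2 n with hK
  have hK1 : 1 ≤ K := Nat.clog_pos (by norm_num) hn2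
  have hlK : 0 ≤ Real.log K := Real.log_nonneg (by exact_mod_cast hK1)
  set t := ⌈4 / (ν / (2 * τ)) * (1 + Real.log K)⌉₊ with ht
  obtain ⟨D, hD, hm⟩ := exists_spanner_of_orderings hn (Nat.le_pow_clog (by norm_num) n) hK1 hτ0
    hν hν1 (Nat.le_ceil _) (Nat.ceil_pos.mpr (by positivity)) pos hpos
  have hbound := edge_bound hn2 hk hν hν1 hε hC₁ hτ0 hK ht rfl hkε hτ
  rw [← hC₀] at hbound
  have hL0 : 0 ≤ Real.log n := Real.log_natCast_nonneg n
  have hA0 : 0 ≤ Real.log (k / ε) := Real.log_nonneg hkε.le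
  have hmax := max_mul_log_sq_le hn2 hk hε hε2
  have hF0 : 0 ≤ Real.log (Real.log n ^ 3 * ((k : ℝ) ^ 4 / ε ^ 2)) ^ 3 := by
    have : 0 ≤ max 1 (Real.log (Real.log n)) * Real.log (k / ε) ^ 2 := by positivity
    linarith
  refine ⟨D, hD, fun H hH => ((hm H hH).trans hbound).trans ?_,
    fun H hH => ((hm H hH).trans hbound).trans ?_⟩
  · gcongr
    have : 0 ≤ 23125 * C₀ ^ 2 := by positivity
    linarith
  · set F := Real.log (Real.log n ^ 3 * ((k : ℝ) ^ 4 / ε ^ 2))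
    set M := max 1 (Real.log (Real.log n))
    calc _ = (n : ℝ) ^ (1 + 1 / (k : ℝ)) * ν⁻¹ * (C₀ ^ 2 *
          (Real.log n ^ 3 * ((k : ℝ) ^ 4 / ε ^ 2)) * (M * Real.log (k / ε) ^ 2)) := by ring
      _ ≤ (n : ℝ) ^ (1 + 1 / (k : ℝ)) * ν⁻¹ * (C₀ ^ 2 *
          (Real.log n ^ 3 * ((k : ℝ) ^ 4 / ε ^ 2)) * (23125 * F ^ 3)) := by gcongr
      _ = (n : ℝ) ^ (1 + 1 / (k : ℝ)) * ν⁻¹ * (23125 * C₀ ^ 2 *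
          (Real.log n ^ 3 * ((k : ℝ) ^ 4 / ε ^ 2)) * F ^ 3) := by ring
      _ ≤ _ := by
        gcongr
        linarith
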